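/- Let $m\ge 1$ be an integer and let $\boldsymbol p=(p_0,\dots,p_m)$ be a probability vector with $p_i>0$ for all $i$. Let $\zeta_m$ be the random noble means substitution on the alphabet $\{a,b\}$: $\zeta_m(b)=a$, and $\zeta_m(a)=a^{i}ba^{m-i}$ with probability $p_i$ $(0\le i\le m)$, where the letters of a word are substituted independently of each other and the images are concatenated. A finite word is *legal* if it is a subword of at least one image of $b$ under $\zeta_m^k$ for some $k\ge 1$; let $\mathcal D_{m,\ell}$ be the set of legal words of length $\ell$. Let $X_m\subset\{a,b\}^{\mathbb Z}$ be the set of accumulation points of sequences whose $k$-th term ($k\ge 0$) is an image of $a|a$ under $\zeta_m^k$ (the bar marks the origin), and let $\mathbb X_m$ be the smallest closed set that contains $X_m$ and is invariant under the shift $S$, $(Sx)_n=x_{n+1}$. For $\ell\ge 1$ let $M_{m,\ell}$ be the matrix indexed by $\mathcal D_{m,\ell}$ whose entry $(u,w)$ is the expected number of positions $0\le k\le |\zeta_m(w_0)|-1$ at which $u$ occurs in the random image $\zeta_m(w)$, where $w_0$ is the first letter of $w$ and $\zeta_m(w_0)$ its image within $\zeta_m(w)$ (this is the substitution matrix of the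 induced substitution on words of length $\ell$). **Theorem.** For every $\ell\ge1$, the matrix $M_{m,\ell}$ has exactly one statistically normalised right Perron–Frobenius eigenvector $\boldsymbol R_{m,\ell}$, that is, an eigenvector for the spectral radius of $M_{m,\ell}$ with positive entries that add up to $1$. There is exactly one Borel measure $\mu_m$ on $\mathbb X_m$ such that $$\mu_m\bigl(\{x\in\mathbb X_m : x_k x_{k+1}\cdots x_{k+\ell-1}=w\}\bigr)=\boldsymbol R_{m,\ell}(w)\qquad\text{for all } \ell\ge 1,\ w\in\mathcal D_{m,\ell},\ k\in\mathbb Z.$$ It is a shift-invariant probability measure, and it is ergodic with respect to $S$. -/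

import Mathlib

open scoped ENNReal

noncomputable section

namespace RNMS

/-! ### Random substitutions on finite words -/

/-- A random substitution on the alphabet `α`: each letter is sent to a random word.
Each letter of a word is substituted independently, see `imageLaw`. -/
abbrev RandomSubst (α : Type) := α → PMF (List α)

variable {α : Type}

/-- The law of the image of a finite word under a random substitution: the images of the
single letters are chosen independently and concatenated. -/
def imageLaw (θ : RandomSubst α) : List α → PMF (List α)
  | [] => PMF.pure []
  | x :: xs => (θ x).bind fun u => (imageLaw θ xs).bind fun v => PMF.pure (u ++ v)

/-- The law of the image of a finite word under the `k`-th power of a random substitution. -/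
def powLaw (θ : RandomSubst α) : ℕ → List α → PMF (List α)
  | 0, w => PMF.pure w
  | k + 1, w => (powLaw θ k w).bind (imageLaw θ)

/-- `v` is (at least) one image of `w` under `θ ^ k`. -/
def IsImage (θ : RandomSubst α) (k : ℕ) (w v : List α) : Prop :=
  v ∈ (powLaw θ k w).support

/-- The substitution matrix: the entry `(i, j)` is the expected number of occurrences of the
letter `i` in the image of the letter `j`. -/
def substMatrix [DecidableEq α] (θ : RandomSubst α) : Matrix α α ℝ :=
  Matrix.of fun i j => (∑' w : List α, θ j w * (w.count i : ℝ≥0∞)).toReal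

/-- The induced substitution on words of length `ℓ`. If `x :: xs` has the image `u ++ v`, with
`u` the image of the first letter `x`, then `x :: xs` is sent to the sequence of the words of
length `ℓ` that start in `u ++ v` at the positions `0, …, |u| - 1`. -/
def inducedSubst (θ : RandomSubst α) (ℓ : ℕ) : RandomSubst (List α)
  | [] => PMF.pure []
  | x :: xs => (θ x).bind fun u => (imageLaw θ xs).bind fun v =>
      PMF.pure ((List.range u.length).map fun k => ((u ++ v).drop k).take ℓ)

/-- `R` is a right Perron-Frobenius eigenvector of `M`, statistically normalised: an eigenvector
for the spectral radius, with positive entries that add up to `1`. -/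
def IsRightPF {ι : Type} [Fintype ι] [DecidableEq ι] (M : Matrix ι ι ℝ) (R : ι → ℝ) : Prop :=
  M.mulVec R = (spectralRadius ℂ (M.map Complex.ofReal)).toReal • R ∧
    (∀ i, 0 < R i) ∧ ∑ i, R i = 1

/-! ### The random noble means substitution -/

/-- The binary alphabet. -/
inductive Letter : Type
  | a : Letter
  | b : Letter
  deriving DecidableEq

instance : Fintype Letter := ⟨{Letter.a, Letter.b}, fun x => by cases x <;> simp⟩

instance : TopologicalSpace Letter := ⊥

instance : DiscreteTopology Letter := ⟨rfl⟩

instance : MeasurableSpace Letter := ⊤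

/-- The word `a ^ i b a ^ (m - i)`. -/
def nobleWord (m : ℕ) (i : Fin (m + 1)) : List Letter :=
  List.replicate i Letter.a ++ Letter.b :: List.replicate (m - i) Letter.a

variable {m : ℕ}

/-- The random noble means substitution with choosing probabilities `p`:
`a ↦ a ^ i b a ^ (m - i)` with probability `p i`, and `b ↦ a`. -/
def nobleSubst (p : PMF (Fin (m + 1))) : RandomSubst Letter
  | Letter.a => p.map (nobleWord m)
  | Letter.b => PMF.pure [Letter.a]

/-- A word is legal if it is a subword of an image of `b` under some power of the
substitution. -/
def Legal (p : PMF (Fin (m + 1))) (w : List Letter) : Prop :=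
  ∃ k : ℕ, 1 ≤ k ∧ ∃ v, IsImage (nobleSubst p) k [Letter.b] v ∧ w <:+: v

/-- The set of legal words of length `ℓ`. -/
abbrev LegalWord (p : PMF (Fin (m + 1))) (ℓ : ℕ) : Type :=
  {w : List Letter // Legal p w ∧ w.length = ℓ}

instance (p : PMF (Fin (m + 1))) (ℓ : ℕ) : Finite (LegalWord p ℓ) :=
  ((List.finite_length_eq Letter ℓ).subset fun _ hw => hw.2 :
    {w : List Letter | Legal p w ∧ w.length = ℓ}.Finite).to_subtype

instance (p : PMF (Fin (m + 1))) (ℓ : ℕ) : Fintype (LegalWord p ℓ) :=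
  Fintype.ofFinite _

/-- The substitution matrix of the induced substitution on the alphabet of legal words of
length `ℓ`. -/
def inducedMatrix (p : PMF (Fin (m + 1))) (ℓ : ℕ) :
    Matrix (LegalWord p ℓ) (LegalWord p ℓ) ℝ :=
  (substMatrix (inducedSubst (nobleSubst p) ℓ)).submatrix Subtype.val Subtype.val

/-! ### The two-sided discrete stochastic hull -/

/-- The shift on bi-infinite sequences. -/
def shift (x : ℤ → Letter) : ℤ → Letter := fun n => x (n + 1)

/-- The pair of words `u | v` as a bi-infinite sequence: `v` occupies the positions
`0, 1, …` and `u` the positions `…, -2, -1`. The remaining positions are filled with `a`;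
this filling plays no role in `generatingWords`, where both lengths tend to infinity. -/
def embedPair (u v : List Letter) : ℤ → Letter := fun n =>
  if 0 ≤ n then v.getD n.toNat Letter.a else u.reverse.getD (-n - 1).toNat Letter.a

/-- The generating random noble means words: the accumulation points of sequences whose `k`-th
term is an image of `a | a` under the `k`-th power of the substitution. -/
def generatingWords (p : PMF (Fin (m + 1))) : Set (ℤ → Letter) :=
  {w | ∃ y : ℕ → ℤ → Letter,
    (∀ k, ∃ u v, IsImage (nobleSubst p) k [Letter.a] u ∧
      IsImage (nobleSubst p) k [Letter.a] v ∧ y k = embedPair u v) ∧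
    MapClusterPt w Filter.atTop y}

/-- The two-sided discrete stochastic hull: the smallest closed and shift-invariant set that
contains all generating words. -/
def hull (p : PMF (Fin (m + 1))) : Set (ℤ → Letter) :=
  ⋂₀ {Y | IsClosed Y ∧ shift '' Y = Y ∧ generatingWords p ⊆ Y}

lemma shift_mem_hull (p : PMF (Fin (m + 1))) {x : ℤ → Letter} (hx : x ∈ hull p) :
    shift x ∈ hull p := by
  intro Y hY
  rw [← hY.2.1]
  exact ⟨x, hx Y hY, rfl⟩

/-- The shift on the hull. -/
def hullShift (p : PMF (Fin (m + 1))) (x : hull p) : hull p :=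
  ⟨shift x, shift_mem_hull p x.2⟩

/-- The cylinder set in the hull of all sequences that carry the word `v` from position `k` on. -/
def cylinder (p : PMF (Fin (m + 1))) (k : ℤ) (v : List Letter) : Set (hull p) :=
  {x | ∀ i : Fin v.length, x.1 (k + (i : ℕ)) = v.get i}

/-- `μ` gives to each cylinder set of a legal word `w` of length `ℓ ≥ 1` the entry at `w` of the
statistically normalised right Perron-Frobenius eigenvector of the induced substitution matrix. -/
def IsNobleMeasure (p : PMF (Fin (m + 1))) (μ : MeasureTheory.Measure (hull p)) : Prop :=
  ∀ ℓ : ℕ, 1 ≤ ℓ → ∃ R : LegalWord p ℓ → ℝ, IsRightPF (inducedMatrix p ℓ) R ∧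
    ∀ (k : ℤ) (w : LegalWord p ℓ), μ (cylinder p k w.1) = ENNReal.ofReal (R w)

end RNMS

end

/-!
The induced matrix `inducedMatrix p ℓ` has an explicit positive left eigenvector. Its entry at a
word is `inflation m` or `1`, according to whether the first letter is `a` or `b`, and its
eigenvalue is `inflation m`, the positive root of `x ^ 2 = m x + 1`. The matrix is primitive,
because each legal word occurs in images of each letter under all large powers
(`isPrimitive_inducedMatrix`). Perron-Frobenius theory then is elementary: a matrix `A` with
positive entries and positive eigenvector `R` acts on the row vectors orthogonal to `R` like
`A - ε J`, `J i j = R i`, and this contracts them (`exists_contraction`). This yields existence and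
uniqueness of the eigenvector and, for a function `φ` of mean zero, that the row vector
`φ` grows slower than the inflation factor under the powers of the matrix.

The powers of the induced matrix count words in images under the powers of the substitution
(`vecMul_inducedMatrix_pow`), so the eigenvectors are the word frequencies in long images. This
makes the eigenvectors for different lengths marginals of each other (`sum_marginal_eq`). They
therefore define a measure on the hull; it is obtained as a limit point of finitely supported
measures, in the compact space of probability measures (`exists_isNobleMeasure`). Since the hull
only carries legal words, the measure is determined by its values on the cylinder sets of legal
words, and it is invariant under the shift.

Ergodicity rests on a law of large numbers. All images of a letter under the `k`-th power have the
same length, and an image under a large power is a concatenation of many independent images under a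
smaller power. A variance estimate shows that the frequency of a word in such images is
concentrated at its mean (`exists_powMean_abs_fullSum_le`), and the eigenvector equation carries
this over to long words distributed according to the eigenvector
(`exists_sum_abs_windowSum_le`). For an invariant set `A` and a cylinder set `C`, the measure of
`A ∩ C` is the integral over `A` of the frequency of the word of `C` in a long window, hence
`μ (A ∩ C) = μ A * μ C`. So `A` is independent of all measurable sets, also of itself.
-/

namespace RNMS

/-! ### Perron-Frobenius theory of a primitive matrix with a known left eigenvector -/

section PerronFrobenius

open Filter Topology Matrix

variable {ι : Type} [Fintype ι]

/-- A matrix with positive entries and the positive right eigenvector `R` contracts the row vectors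
orthogonal to `R`, in the norm `∑ |φ i| R i`: on these row vectors it acts like `A - ε J`, where
`J i j = R i`, and `A - ε J` still has nonnegative entries for small `ε`. -/
lemma exists_contraction [Nonempty ι] {A : Matrix ι ι ℝ} {R : ι → ℝ} {ρ : ℝ}
    (hA : ∀ i j, 0 < A i j) (hR : ∀ i, 0 < R i) (hAR : A *ᵥ R = ρ • R) :
    ∃ q < ρ, ∀ φ : ι → ℝ, φ ⬝ᵥ R = 0 → |φ ᵥ* A| ⬝ᵥ R ≤ q * (|φ| ⬝ᵥ R) := by
  obtain ⟨⟨i₀, j₀⟩, hmin⟩ := Finite.exists_min fun x : ι × ι => A x.1 x.2 / R x.1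
  set ε := A i₀ j₀ / R i₀ with hε
  have hεpos : 0 < ε := div_pos (hA _ _) (hR _)
  have hle : ∀ i j, ε * R i ≤ A i j := fun i j => by
    have := hmin (i, j)
    rwa [le_div_iff₀ (hR _)] at this
  have hsum : 0 < ∑ i, R i := Finset.sum_pos (fun i _ => hR i) Finset.univ_nonempty
  refine ⟨ρ - ε * ∑ i, R i, by nlinarith, fun φ hφ => ?_⟩
  have key : ∀ j, |(φ ᵥ* A) j| ≤ (|φ| ᵥ* A) j - ε * (|φ| ⬝ᵥ R) := by
    intro j
    have h1 : (φ ᵥ* A) j = ∑ i, φ i * (A i j - ε * R i) := by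
      have : ε * ∑ i, φ i * R i = 0 := by
        rw [show ∑ i, φ i * R i = 0 from hφ, mul_zero]
      simp only [vecMul, dotProduct, mul_sub, Finset.sum_sub_distrib]
      rw [show ∑ i, φ i * (ε * R i) = ε * ∑ i, φ i * R i by
        rw [Finset.mul_sum]; exact Finset.sum_congr rfl fun i _ => by ring, this, sub_zero]
    have h2 : (|φ| ᵥ* A) j - ε * (|φ| ⬝ᵥ R) = ∑ i, |φ i| * (A i j - ε * R i) := by
      simp only [vecMul, dotProduct, mul_sub, Finset.sum_sub_distrib, Pi.abs_apply]
      congr 1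
      rw [Finset.mul_sum]; exact Finset.sum_congr rfl fun i _ => by ring
    rw [h1, h2]
    refine (Finset.abs_sum_le_sum_abs _ _).trans (Finset.sum_le_sum fun i _ => ?_)
    rw [abs_mul, abs_of_nonneg (sub_nonneg.2 (hle i j))]
  calc |φ ᵥ* A| ⬝ᵥ R ≤ ∑ j, ((|φ| ᵥ* A) j - ε * (|φ| ⬝ᵥ R)) * R j :=
        Finset.sum_le_sum fun j _ => mul_le_mul_of_nonneg_right (key j) (hR j).le
    _ = (|φ| ᵥ* A) ⬝ᵥ R - ε * (|φ| ⬝ᵥ R) * ∑ j, R j := by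
        simp only [sub_mul, Finset.sum_sub_distrib, ← Finset.mul_sum]; rfl
    _ = (ρ - ε * ∑ i, R i) * (|φ| ⬝ᵥ R) := by
        rw [← dotProduct_mulVec, hAR, dotProduct_smul, smul_eq_mul]; ring

variable [DecidableEq ι] {M : Matrix ι ι ℝ} {h R : ι → ℝ} {lam : ℝ}

lemma pow_mulVec_eq_of_mulVec_eq (hMR : M *ᵥ R = lam • R) (k : ℕ) :
    (M ^ k) *ᵥ R = lam ^ k • R := by
  induction k with
  | zero => simp
  | succ k ih => rw [pow_succ, ← mulVec_mulVec, hMR, mulVec_smul, ih, smul_smul, pow_succ']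

lemma vecMul_pow_eq_of_vecMul_eq (hhM : h ᵥ* M = lam • h) (k : ℕ) :
    h ᵥ* (M ^ k) = lam ^ k • h := by
  induction k with
  | zero => simp
  | succ k ih => rw [pow_succ, ← vecMul_vecMul, ih, smul_vecMul, hhM, smul_smul, pow_succ]

/-- Row vectors orthogonal to the Perron-Frobenius eigenvector grow slower than `lam ^ k`. -/
lemma tendsto_vecMul_pow_div (hM : M.IsPrimitive) (hlam : 0 < lam) (hR : ∀ i, 0 < R i)
    (hMR : M *ᵥ R = lam • R) {φ : ι → ℝ} (hφ : φ ⬝ᵥ R = 0) (i : ι) :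
    Tendsto (fun k : ℕ => (φ ᵥ* M ^ k) i / lam ^ k) atTop (𝓝 0) := by
  have : Nonempty ι := ⟨i⟩
  obtain ⟨N, hN0, hN⟩ := hM.exists_pos_pow
  obtain ⟨q, hq, hcon⟩ := exists_contraction hN hR (pow_mulVec_eq_of_mulVec_eq hMR N)
  -- `a` is decreasing, and decays geometrically along the multiples of `N`.
  set a : ℕ → ℝ := fun k => (|φ ᵥ* M ^ k| ⬝ᵥ R) / lam ^ k with ha
  have hnn : ∀ ψ : ι → ℝ, 0 ≤ |ψ| ⬝ᵥ R := fun ψ =>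
    Finset.sum_nonneg fun j _ => mul_nonneg (abs_nonneg _) (hR j).le
  have ha0 : ∀ k, 0 ≤ a k := fun k => div_nonneg (hnn _) (pow_pos hlam k).le
  have horth : ∀ k, (φ ᵥ* M ^ k) ⬝ᵥ R = 0 := fun k => by
    rw [← dotProduct_mulVec, pow_mulVec_eq_of_mulVec_eq hMR, dotProduct_smul, hφ, smul_zero]
  have hanti : Antitone a := antitone_nat_of_succ_le fun k => by
    have h1 : |φ ᵥ* M ^ (k + 1)| ⬝ᵥ R ≤ lam * (|φ ᵥ* M ^ k| ⬝ᵥ R) := by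
      calc |φ ᵥ* M ^ (k + 1)| ⬝ᵥ R ≤ (|φ ᵥ* M ^ k| ᵥ* M) ⬝ᵥ R := by
            refine Finset.sum_le_sum fun j _ => mul_le_mul_of_nonneg_right ?_ (hR j).le
            rw [pow_succ, ← vecMul_vecMul, Pi.abs_apply]
            refine (Finset.abs_sum_le_sum_abs _ _).trans (Finset.sum_le_sum fun i _ => ?_)
            rw [abs_mul, abs_of_nonneg (hM.nonneg _ _)]; rfl
        _ = _ := by rw [← dotProduct_mulVec, hMR, dotProduct_smul, smul_eq_mul]
    simp only [ha]
    rw [div_le_div_iff₀ (pow_pos hlam _) (pow_pos hlam _), pow_succ lam]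
    nlinarith [pow_pos hlam k]
  have hpow : ∀ n : ℕ, a (N * n) ≤ (max q 0 / lam ^ N) ^ n * a 0 := by
    intro n
    induction n with
    | zero => simp
    | succ n ih =>
      have h1 := hcon _ (horth (N * n))
      rw [vecMul_vecMul, ← pow_add] at h1
      have hl := pow_pos hlam (N * n)
      have hl' := pow_pos hlam N
      calc a (N * (n + 1)) ≤ max q 0 / lam ^ N * a (N * n) := by
            simp only [ha, mul_add, mul_one]
            rw [pow_add lam, div_mul_div_comm, mul_comm (lam ^ N)]
            exact div_le_div_of_nonneg_right
              (h1.trans (mul_le_mul_of_nonneg_right (le_max_left _ _) (hnn _))) (by positivity)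
        _ ≤ _ := by
            rw [pow_succ', mul_assoc]
            exact mul_le_mul_of_nonneg_left ih (by positivity)
  have hq1 : max q 0 / lam ^ N < 1 := by
    rw [div_lt_one (pow_pos hlam N)]; exact max_lt hq (pow_pos hlam N)
  have hsub : Tendsto (fun n : ℕ => a (N * n)) atTop (𝓝 0) := by
    refine squeeze_zero (fun n => ha0 _) hpow ?_
    simpa using (tendsto_pow_atTop_nhds_zero_of_lt_one
      (div_nonneg (le_max_right q 0) (pow_pos hlam N).le) hq1).mul_const (a 0)
  have hmul : Tendsto (fun n : ℕ => N * n) atTop atTop :=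
    tendsto_id.const_mul_atTop' hN0
  have hlim : Tendsto a atTop (𝓝 0) :=
    (tendsto_iff_tendsto_subseq_of_antitone hanti hmul).2 hsub
  refine squeeze_zero_norm (a := fun k => a k / R i) (fun k => ?_)
    (by simpa using hlim.div_const (R i))
  rw [Real.norm_eq_abs, abs_div, abs_of_pos (pow_pos hlam k)]
  simp only [ha]
  rw [div_div, div_le_div_iff₀ (pow_pos hlam k) (mul_pos (pow_pos hlam k) (hR i))]
  have : |(φ ᵥ* M ^ k) i| * R i ≤ |φ ᵥ* M ^ k| ⬝ᵥ R :=
    Finset.single_le_sum (f := fun j => |φ ᵥ* M ^ k| j * R j)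
      (fun j _ => mul_nonneg (abs_nonneg _) (hR j).le) (Finset.mem_univ i)
  nlinarith [pow_pos hlam k]

/-- The eigenvalue of a positive left eigenvector of a nonnegative matrix is its spectral radius. -/
lemma spectralRadius_eq_of_vecMul_eq [Nonempty ι] (hM : ∀ i j, 0 ≤ M i j) (hlam : 0 < lam)
    (hh : ∀ i, 0 < h i) (hhM : h ᵥ* M = lam • h) :
    (spectralRadius ℂ (M.map Complex.ofReal)).toReal = lam := by
  have hspec : ∀ z : ℂ, z ∈ spectrum ℂ (M.map Complex.ofReal) ↔
      (algebraMap ℂ (Matrix ι ι ℂ) z - M.map Complex.ofReal).det = 0 := fun z => by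
    rw [spectrum.mem_iff, isUnit_iff_isUnit_det, isUnit_iff_ne_zero, not_not]
  have hsub : ∀ (z : ℂ) (v : ι → ℂ), (algebraMap ℂ (Matrix ι ι ℂ) z) *ᵥ v = z • v := fun z v => by
    rw [Algebra.algebraMap_eq_smul_one, smul_mulVec, one_mulVec]
  have hsup : spectralRadius ℂ (M.map Complex.ofReal) = ENNReal.ofReal lam := by
    apply le_antisymm
    · -- An eigenvector `v` for `z` satisfies `|z| |v| ≤ M |v|`; pair this with `h`.
      refine iSup₂_le fun z hz => ?_
      obtain ⟨v, hv0, hv⟩ := exists_mulVec_eq_zero_iff.2 ((hspec z).1 hz)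
      rw [sub_mulVec, hsub, sub_eq_zero] at hv
      have h1 : ∀ i, ‖z‖ * ‖v i‖ ≤ ∑ j, M i j * ‖v j‖ := fun i => by
        have := congrFun hv i
        rw [Pi.smul_apply, smul_eq_mul] at this
        rw [← norm_mul, this]
        refine (norm_sum_le _ _).trans (Finset.sum_le_sum fun j _ => ?_)
        change ‖(M i j : ℂ) * v j‖ ≤ _
        rw [norm_mul, Complex.norm_real, Real.norm_of_nonneg (hM i j)]
      have h2 : ‖z‖ * ∑ i, h i * ‖v i‖ ≤ lam * ∑ i, h i * ‖v i‖ := by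
        calc ‖z‖ * ∑ i, h i * ‖v i‖ = ∑ i, h i * (‖z‖ * ‖v i‖) := by
              rw [Finset.mul_sum]; exact Finset.sum_congr rfl fun i _ => by ring
          _ ≤ h ⬝ᵥ (M *ᵥ fun j => ‖v j‖) :=
              Finset.sum_le_sum fun i _ => mul_le_mul_of_nonneg_left (h1 i) (hh i).le
          _ = lam * ∑ i, h i * ‖v i‖ := by
              rw [dotProduct_mulVec, hhM, smul_dotProduct]; rfl
      have h3 : 0 < ∑ i, h i * ‖v i‖ := by
        obtain ⟨i, hi⟩ := Function.ne_iff.1 hv0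
        exact Finset.sum_pos' (fun j _ => mul_nonneg (hh j).le (norm_nonneg _))
          ⟨i, Finset.mem_univ i, mul_pos (hh i) (norm_pos_iff.2 hi)⟩
      have h4 : ‖z‖ ≤ lam := le_of_mul_le_mul_right h2 h3
      rw [← enorm_eq_nnnorm, ← ofReal_norm]
      exact ENNReal.ofReal_le_ofReal h4
    · have hmem : (lam : ℂ) ∈ spectrum ℂ (M.map Complex.ofReal) := by
        rw [hspec, ← exists_vecMul_eq_zero_iff]
        refine ⟨fun i => (h i : ℂ), fun h0 => ?_, ?_⟩
        · obtain ⟨i⟩ := ‹Nonempty ι›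
          have := congrFun h0 i
          simp only [Pi.zero_apply, Complex.ofReal_eq_zero] at this
          exact (hh i).ne' this
        · rw [vecMul_sub, Algebra.algebraMap_eq_smul_one, vecMul_smul, vecMul_one, sub_eq_zero]
          ext j
          have := congrArg Complex.ofReal (congrFun hhM j)
          simp only [vecMul, dotProduct, Complex.ofReal_sum, Complex.ofReal_mul, Pi.smul_apply,
            smul_eq_mul] at this
          simpa [vecMul, dotProduct] using this.symm
      refine le_trans ?_ (le_iSup₂ (f := fun (z : ℂ) (_ : z ∈ spectrum ℂ (M.map Complex.ofReal)) =>
        (‖z‖₊ : ℝ≥0∞)) (lam : ℂ) hmem)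
      rw [← enorm_eq_nnnorm, ← ofReal_norm, Complex.norm_real, Real.norm_of_nonneg hlam.le]
  rw [hsup, ENNReal.toReal_ofReal hlam.le]

/-- A primitive matrix with a positive left eigenvector has exactly one statistically normalised
right Perron-Frobenius eigenvector. -/
lemma existsUnique_isRightPF [Nonempty ι] (hM : M.IsPrimitive) (hlam : 0 < lam)
    (hh : ∀ i, 0 < h i) (hhM : h ᵥ* M = lam • h) : ∃! R, IsRightPF M R := by
  have hrad := spectralRadius_eq_of_vecMul_eq hM.nonneg hlam hh hhM
  obtain ⟨N, hN0, hN⟩ := hM.exists_pos_pow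
  have hex : ∃ R, IsRightPF M R := by
    have hdet : (lam • (1 : Matrix ι ι ℝ) - M).det = 0 := by
      rw [← exists_vecMul_eq_zero_iff]
      refine ⟨h, fun h0 => ?_, ?_⟩
      · obtain ⟨i⟩ := ‹Nonempty ι›
        exact (hh i).ne' (congrFun h0 i)
      · rw [vecMul_sub, vecMul_smul, vecMul_one, hhM, sub_self]
    obtain ⟨z, hz0, hz⟩ := exists_mulVec_eq_zero_iff.2 hdet
    rw [sub_mulVec, smul_mulVec, one_mulVec, sub_eq_zero] at hz
    -- `M |z| - lam |z|` is nonnegative and orthogonal to `h`, hence zero.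
    have hle : ∀ i, 0 ≤ (M *ᵥ |z|) i - lam * |z| i := fun i => by
      have h1 : lam * z i = (M *ᵥ z) i := congrFun hz i
      have h2 : lam * |z| i = |(M *ᵥ z) i| := by
        rw [← h1, abs_mul, abs_of_pos hlam, Pi.abs_apply]
      rw [sub_nonneg, h2]
      refine (Finset.abs_sum_le_sum_abs _ _).trans (Finset.sum_le_sum fun j _ => ?_)
      rw [abs_mul, abs_of_nonneg (hM.nonneg _ _)]; rfl
    have hpair : ∑ i, h i * ((M *ᵥ |z|) i - lam * |z| i) = 0 := by
      have : h ⬝ᵥ (M *ᵥ |z|) = lam * (h ⬝ᵥ |z|) := by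
        rw [dotProduct_mulVec, hhM, smul_dotProduct, smul_eq_mul]
      simp only [mul_sub, Finset.sum_sub_distrib]
      rw [sub_eq_zero]
      refine this.trans ?_
      rw [dotProduct, Finset.mul_sum]
      exact Finset.sum_congr rfl fun i _ => by ring
    have heq : M *ᵥ |z| = lam • |z| := by
      ext i
      have := (Finset.sum_eq_zero_iff_of_nonneg fun i _ => mul_nonneg (hh i).le (hle i)).1 hpair i
        (Finset.mem_univ i)
      have := (mul_eq_zero.1 this).resolve_left (hh i).ne'
      simpa [sub_eq_zero] using this
    obtain ⟨j, hj⟩ := Function.ne_iff.1 hz0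
    have hpos : ∀ i, 0 < |z| i := fun i => by
      have h1 := congrFun (pow_mulVec_eq_of_mulVec_eq heq N) i
      have h2 : 0 < ((M ^ N) *ᵥ |z|) i :=
        Finset.sum_pos' (fun k _ => mul_nonneg (hN i k).le (abs_nonneg _))
          ⟨j, Finset.mem_univ j, mul_pos (hN i j) (abs_pos.2 hj)⟩
      rw [h1, Pi.smul_apply, smul_eq_mul] at h2
      exact (pos_iff_pos_of_mul_pos h2).1 (pow_pos hlam N)
    have hs : 0 < ∑ i, |z| i := Finset.sum_pos (fun i _ => hpos i) Finset.univ_nonempty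
    refine ⟨(∑ i, |z| i)⁻¹ • |z|, ?_, fun i => mul_pos (inv_pos.2 hs) (hpos i), ?_⟩
    · rw [hrad, mulVec_smul, heq, smul_comm]
    · simp only [Pi.smul_apply, smul_eq_mul, ← Finset.mul_sum]
      exact inv_mul_cancel₀ hs.ne'
  obtain ⟨R, hR⟩ := hex
  refine ⟨R, hR, fun R' hR' => ?_⟩
  obtain ⟨hR1, hR2, hR3⟩ := hR
  obtain ⟨hR1', hR2', hR3'⟩ := hR'
  rw [hrad] at hR1 hR1'
  -- The transpose of `M ^ N` contracts the vectors orthogonal to `h`.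
  obtain ⟨q, hq, hcon⟩ := exists_contraction (A := (M ^ N)ᵀ) (fun i j => hN j i) hh
    (by rw [mulVec_transpose]; exact vecMul_pow_eq_of_vecMul_eq hhM N)
  have hpR : 0 < R ⬝ᵥ h := Finset.sum_pos (fun i _ => mul_pos (hR2 i) (hh i)) Finset.univ_nonempty
  set t := (R' ⬝ᵥ h) / (R ⬝ᵥ h) with ht
  set z := R' - t • R with hz
  have hz0 : z ⬝ᵥ h = 0 := by
    rw [hz, sub_dotProduct, smul_dotProduct, smul_eq_mul, ht, div_mul_cancel₀ _ hpR.ne', sub_self]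
  have hMz : M *ᵥ z = lam • z := by
    rw [hz, mulVec_sub, mulVec_smul, hR1, hR1', smul_sub, smul_comm]
  have h1 := hcon z hz0
  have habs : |lam ^ N • z| = lam ^ N • |z| := by
    ext i
    simp [abs_mul, abs_of_pos hlam]
  rw [vecMul_transpose, pow_mulVec_eq_of_mulVec_eq hMz, habs, smul_dotProduct, smul_eq_mul] at h1
  have hzz : ∀ i, z i = 0 := by
    have h2 : |z| ⬝ᵥ h = 0 := by
      have : 0 ≤ |z| ⬝ᵥ h := Finset.sum_nonneg fun j _ => mul_nonneg (abs_nonneg _) (hh j).le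
      nlinarith
    intro i
    have := (Finset.sum_eq_zero_iff_of_nonneg
      fun j _ => mul_nonneg (abs_nonneg (z j)) (hh j).le).1 h2 i (Finset.mem_univ i)
    exact abs_eq_zero.1 ((mul_eq_zero.1 this).resolve_right (hh i).ne')
  have hRR : ∀ i, R' i = t * R i := fun i => by
    have := hzz i
    simpa [hz, sub_eq_zero] using this
  have ht1 : t = 1 := by
    rw [← hR3', Finset.sum_congr rfl fun i _ => hRR i, ← Finset.mul_sum, hR3, mul_one]
  ext i
  rw [hRR, ht1, one_mul]

end PerronFrobenius

/-! ### Expectations over random images -/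

section Means

variable {m : ℕ} (p : PMF (Fin (m + 1)))

/-- Expectation over the random image of a letter. -/
noncomputable def letterMean : Letter → (List Letter → ℝ) →ₗ[ℝ] ℝ
  | Letter.a => ∑ i, (p i).toReal • LinearMap.proj (nobleWord m i)
  | Letter.b => LinearMap.proj [Letter.a]

/-- Expectation over the random image of a word. All random images have finite support, so that
expectations of arbitrary real functions are finite sums; packing them as linear functionals keeps
summability out of the argument. -/
noncomputable def wordMean : List Letter → (List Letter → ℝ) →ₗ[ℝ] ℝ
  | [] => LinearMap.proj []
  | x :: xs => letterMean p x ∘ₗ LinearMap.pi fun u =>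
      wordMean xs ∘ₗ LinearMap.funLeft ℝ ℝ (u ++ ·)

/-- Expectation over the random image of a word under the `k`-th power of the substitution. -/
noncomputable def powMean : ℕ → List Letter → (List Letter → ℝ) →ₗ[ℝ] ℝ
  | 0, w => LinearMap.proj w
  | k + 1, w => powMean k w ∘ₗ LinearMap.pi fun v => wordMean p v

lemma letterMean_a (f : List Letter → ℝ) :
    letterMean p Letter.a f = ∑ i, (p i).toReal * f (nobleWord m i) := by
  simp [letterMean]

lemma letterMean_b (f : List Letter → ℝ) : letterMean p Letter.b f = f [Letter.a] := rfl

lemma wordMean_nil (f : List Letter → ℝ) : wordMean p [] f = f [] := rfl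

lemma wordMean_cons (x : Letter) (xs : List Letter) (f : List Letter → ℝ) :
    wordMean p (x :: xs) f = letterMean p x fun u => wordMean p xs fun v => f (u ++ v) := rfl

lemma powMean_zero (w : List Letter) (f : List Letter → ℝ) : powMean p 0 w f = f w := rfl

lemma powMean_succ (k : ℕ) (w : List Letter) (f : List Letter → ℝ) :
    powMean p (k + 1) w f = powMean p k w fun v => wordMean p v f := rfl

variable {p}

lemma mem_support_nobleSubst_a {u : List Letter} :
    u ∈ (nobleSubst p Letter.a).support ↔ ∃ i, p i ≠ 0 ∧ nobleWord m i = u := by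
  simp [nobleSubst]

lemma mem_support_nobleSubst_b {u : List Letter} :
    u ∈ (nobleSubst p Letter.b).support ↔ u = [Letter.a] := by
  simp [nobleSubst]

lemma mem_support_imageLaw_nil {v : List Letter} :
    v ∈ (imageLaw (nobleSubst p) []).support ↔ v = [] := by
  simp [imageLaw]

lemma mem_support_imageLaw_cons {x : Letter} {xs v : List Letter} :
    v ∈ (imageLaw (nobleSubst p) (x :: xs)).support ↔ ∃ u ∈ (nobleSubst p x).support,
      ∃ u' ∈ (imageLaw (nobleSubst p) xs).support, v = u ++ u' := by
  simp only [imageLaw, PMF.mem_support_bind_iff, PMF.mem_support_pure_iff]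

lemma isImage_zero {w v : List Letter} : IsImage (nobleSubst p) 0 w v ↔ v = w := by
  simp [IsImage, powLaw]

lemma isImage_succ {k : ℕ} {w v : List Letter} :
    IsImage (nobleSubst p) (k + 1) w v ↔
      ∃ u, IsImage (nobleSubst p) k w u ∧ v ∈ (imageLaw (nobleSubst p) u).support := by
  simp only [IsImage, powLaw, PMF.mem_support_bind_iff]

lemma letterMean_mono {x : Letter} {f g : List Letter → ℝ}
    (h : ∀ u ∈ (nobleSubst p x).support, f u ≤ g u) : letterMean p x f ≤ letterMean p x g := by
  cases x with
  | a =>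
    rw [letterMean_a, letterMean_a]
    refine Finset.sum_le_sum fun i _ => ?_
    by_cases hi : p i = 0
    · simp [hi]
    · exact mul_le_mul_of_nonneg_left (h _ (mem_support_nobleSubst_a.2 ⟨i, hi, rfl⟩))
        ENNReal.toReal_nonneg
  | b => exact h _ (mem_support_nobleSubst_b.2 rfl)

lemma wordMean_mono {w : List Letter} {f g : List Letter → ℝ}
    (h : ∀ v ∈ (imageLaw (nobleSubst p) w).support, f v ≤ g v) :
    wordMean p w f ≤ wordMean p w g := by
  induction w generalizing f g with
  | nil => exact h _ (mem_support_imageLaw_nil.2 rfl)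
  | cons x xs ih =>
    exact letterMean_mono fun u hu => ih fun v hv =>
      h _ (mem_support_imageLaw_cons.2 ⟨u, hu, v, hv, rfl⟩)

lemma powMean_mono {k : ℕ} {w : List Letter} {f g : List Letter → ℝ}
    (h : ∀ v, IsImage (nobleSubst p) k w v → f v ≤ g v) : powMean p k w f ≤ powMean p k w g := by
  induction k generalizing f g with
  | zero => exact h _ (isImage_zero.2 rfl)
  | succ k ih =>
    exact ih fun v hv => wordMean_mono fun u hu => h _ (isImage_succ.2 ⟨v, hv, hu⟩)

lemma letterMean_congr {x : Letter} {f g : List Letter → ℝ}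
    (h : ∀ u ∈ (nobleSubst p x).support, f u = g u) : letterMean p x f = letterMean p x g :=
  le_antisymm (letterMean_mono fun u hu => (h u hu).le) (letterMean_mono fun u hu => (h u hu).ge)

lemma wordMean_congr {w : List Letter} {f g : List Letter → ℝ}
    (h : ∀ v ∈ (imageLaw (nobleSubst p) w).support, f v = g v) :
    wordMean p w f = wordMean p w g :=
  le_antisymm (wordMean_mono fun u hu => (h u hu).le) (wordMean_mono fun u hu => (h u hu).ge)

lemma powMean_congr {k : ℕ} {w : List Letter} {f g : List Letter → ℝ}
    (h : ∀ v, IsImage (nobleSubst p) k w v → f v = g v) : powMean p k w f = powMean p k w g :=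
  le_antisymm (powMean_mono fun u hu => (h u hu).le) (powMean_mono fun u hu => (h u hu).ge)

variable (p) in
lemma letterMean_const (x : Letter) (c : ℝ) : letterMean p x (fun _ => c) = c := by
  cases x with
  | a =>
    have h1 : ∑ i, (p i).toReal = 1 := by
      have h2 := p.tsum_coe
      rw [tsum_fintype] at h2
      rw [← ENNReal.toReal_sum fun i _ => p.apply_ne_top i, h2, ENNReal.toReal_one]
    rw [letterMean_a, ← Finset.sum_mul, h1, one_mul]
  | b => rfl

variable (p) in
lemma wordMean_const (w : List Letter) (c : ℝ) : wordMean p w (fun _ => c) = c := by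
  induction w with
  | nil => rfl
  | cons x xs ih => rw [wordMean_cons]; simp only [ih]; exact letterMean_const p x c

variable (p) in
lemma powMean_const (k : ℕ) (w : List Letter) (c : ℝ) : powMean p k w (fun _ => c) = c := by
  induction k with
  | zero => rfl
  | succ k ih => rw [powMean_succ]; simp only [wordMean_const, ih]

lemma letterMean_pos {x : Letter} {f : List Letter → ℝ} (hf : ∀ u, 0 ≤ f u) {u : List Letter}
    (hu : u ∈ (nobleSubst p x).support) (hfu : 0 < f u) : 0 < letterMean p x f := by
  cases x with
  | a =>
    rw [letterMean_a]
    obtain ⟨i, hi, rfl⟩ := mem_support_nobleSubst_a.1 hu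
    exact Finset.sum_pos' (fun j _ => mul_nonneg ENNReal.toReal_nonneg (hf _))
      ⟨i, Finset.mem_univ i, mul_pos (ENNReal.toReal_pos hi (p.apply_ne_top i)) hfu⟩
  | b => rwa [mem_support_nobleSubst_b.1 hu] at hfu

lemma wordMean_nonneg {w : List Letter} {f : List Letter → ℝ} (hf : ∀ u, 0 ≤ f u) :
    0 ≤ wordMean p w f := by
  rw [← wordMean_const p w 0]; exact wordMean_mono fun u _ => hf u

lemma powMean_nonneg {k : ℕ} {w : List Letter} {f : List Letter → ℝ} (hf : ∀ u, 0 ≤ f u) :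
    0 ≤ powMean p k w f := by
  rw [← powMean_const p k w 0]; exact powMean_mono fun u _ => hf u

lemma wordMean_pos {w : List Letter} {f : List Letter → ℝ} (hf : ∀ u, 0 ≤ f u) {v : List Letter}
    (hv : v ∈ (imageLaw (nobleSubst p) w).support) (hfv : 0 < f v) : 0 < wordMean p w f := by
  induction w generalizing f v with
  | nil => rwa [mem_support_imageLaw_nil.1 hv] at hfv
  | cons x xs ih =>
    obtain ⟨u, hu, u', hu', rfl⟩ := mem_support_imageLaw_cons.1 hv
    exact letterMean_pos (fun u => wordMean_nonneg fun v => hf _) hu (ih (fun v => hf _) hu' hfv)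

lemma powMean_pos {k : ℕ} {w : List Letter} {f : List Letter → ℝ} (hf : ∀ u, 0 ≤ f u)
    {v : List Letter} (hv : IsImage (nobleSubst p) k w v) (hfv : 0 < f v) :
    0 < powMean p k w f := by
  induction k generalizing f v with
  | zero => rwa [isImage_zero.1 hv] at hfv
  | succ k ih =>
    obtain ⟨u, hu, huv⟩ := isImage_succ.1 hv
    exact ih (fun u => wordMean_nonneg hf) hu (wordMean_pos hf huv hfv)

lemma abs_powMean_le {k : ℕ} {w : List Letter} {f : List Letter → ℝ} {c : ℝ}
    (h : ∀ v, IsImage (nobleSubst p) k w v → |f v| ≤ c) : |powMean p k w f| ≤ c := by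
  rw [abs_le]
  constructor
  · rw [← powMean_const p k w (-c)]
    exact powMean_mono fun v hv => (abs_le.1 (h v hv)).1
  · rw [← powMean_const p k w c]
    exact powMean_mono fun v hv => (abs_le.1 (h v hv)).2

variable (p)

lemma powMean_nil (k : ℕ) (f : List Letter → ℝ) : powMean p k [] f = f [] := by
  induction k generalizing f with
  | zero => rfl
  | succ k ih => rw [powMean_succ, ih, wordMean_nil]

lemma wordMean_append (u v : List Letter) (f : List Letter → ℝ) :
    wordMean p (u ++ v) f = wordMean p u fun u' => wordMean p v fun v' => f (u' ++ v') := by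
  induction u generalizing f with
  | nil => rfl
  | cons x xs ih =>
    rw [List.cons_append, wordMean_cons, wordMean_cons]
    simp only [ih, List.append_assoc]

/-- Fubini: the order of two expectations can be exchanged. -/
lemma wordMean_comm (w : List Letter) (L : (List Letter → ℝ) →ₗ[ℝ] ℝ)
    (f : List Letter → List Letter → ℝ) :
    wordMean p w (fun u => L fun v => f u v) = L fun v => wordMean p w fun u => f u v := by
  induction w generalizing f with
  | nil => rfl
  | cons x xs ih =>
    simp only [wordMean_cons, ih]
    cases x with
    | a =>
      simp only [letterMean_a]
      have : (fun v => ∑ i, (p i).toReal * wordMean p xs fun u => f (nobleWord m i ++ u) v) =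
          ∑ i, (p i).toReal • fun v => wordMean p xs fun u => f (nobleWord m i ++ u) v := by
        ext v; simp
      rw [this, map_sum]
      simp only [map_smul, smul_eq_mul]
    | b => rfl

/-- The images of the two parts of a concatenation are independent. -/
lemma powMean_append (k : ℕ) (u v : List Letter) (f : List Letter → ℝ) :
    powMean p k (u ++ v) f = powMean p k u fun u' => powMean p k v fun v' => f (u' ++ v') := by
  induction k generalizing f with
  | zero => rfl
  | succ k ih =>
    simp only [powMean_succ, ih, wordMean_append]
    congr 1
    ext u'
    rw [wordMean_comm]

lemma powMean_cons (k : ℕ) (x : Letter) (w : List Letter) (f : List Letter → ℝ) :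
    powMean p k (x :: w) f = powMean p k [x] fun u => powMean p k w fun v => f (u ++ v) :=
  powMean_append p k [x] w f

lemma powMean_add (j k : ℕ) (w : List Letter) (f : List Letter → ℝ) :
    powMean p (j + k) w f = powMean p j w fun v => powMean p k v f := by
  induction k generalizing f with
  | zero => rfl
  | succ k ih => rw [← add_assoc, powMean_succ, ih]; rfl

variable {p}

lemma mem_support_imageLaw_append {w₁ w₂ v : List Letter} :
    v ∈ (imageLaw (nobleSubst p) (w₁ ++ w₂)).support ↔
      ∃ v₁ ∈ (imageLaw (nobleSubst p) w₁).support,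
      ∃ v₂ ∈ (imageLaw (nobleSubst p) w₂).support, v = v₁ ++ v₂ := by
  induction w₁ generalizing v with
  | nil => simp only [List.nil_append, mem_support_imageLaw_nil, exists_eq_left, exists_eq_right']
  | cons x xs ih =>
    simp only [List.cons_append, mem_support_imageLaw_cons, ih]
    constructor
    · rintro ⟨u, hu, _, ⟨v₁, h₁, v₂, h₂, rfl⟩, rfl⟩
      exact ⟨u ++ v₁, ⟨u, hu, v₁, h₁, rfl⟩, v₂, h₂, by simp⟩
    · rintro ⟨_, ⟨u, hu, v₁, h₁, rfl⟩, v₂, h₂, rfl⟩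
      exact ⟨u, hu, v₁ ++ v₂, ⟨v₁, h₁, v₂, h₂, rfl⟩, by simp⟩

lemma isImage_append {k : ℕ} {w₁ w₂ v : List Letter} :
    IsImage (nobleSubst p) k (w₁ ++ w₂) v ↔ ∃ v₁, IsImage (nobleSubst p) k w₁ v₁ ∧
      ∃ v₂, IsImage (nobleSubst p) k w₂ v₂ ∧ v = v₁ ++ v₂ := by
  induction k generalizing v with
  | zero => simp [isImage_zero]
  | succ k ih =>
    simp only [isImage_succ, ih]
    constructor
    · rintro ⟨_, ⟨v₁, h₁, v₂, h₂, rfl⟩, hv⟩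
      obtain ⟨u₁, hu₁, u₂, hu₂, rfl⟩ := mem_support_imageLaw_append.1 hv
      exact ⟨u₁, ⟨v₁, h₁, hu₁⟩, u₂, ⟨v₂, h₂, hu₂⟩, rfl⟩
    · rintro ⟨u₁, ⟨v₁, h₁, hu₁⟩, u₂, ⟨v₂, h₂, hu₂⟩, rfl⟩
      exact ⟨_, ⟨v₁, h₁, v₂, h₂, rfl⟩, mem_support_imageLaw_append.2 ⟨u₁, hu₁, u₂, hu₂, rfl⟩⟩

lemma isImage_add {j k : ℕ} {w v : List Letter} :
    IsImage (nobleSubst p) (j + k) w v ↔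
      ∃ u, IsImage (nobleSubst p) j w u ∧ IsImage (nobleSubst p) k u v := by
  induction k generalizing v with
  | zero => simp [isImage_zero]
  | succ k ih =>
    rw [← add_assoc]
    simp only [isImage_succ, ih]
    constructor
    · rintro ⟨u, ⟨u', h₁, h₂⟩, h₃⟩; exact ⟨u', h₁, u, h₂, h₃⟩
    · rintro ⟨u', h₁, u, h₂, h₃⟩; exact ⟨u, ⟨u', h₁, h₂⟩, h₃⟩

lemma isImage_one {w v : List Letter} :
    IsImage (nobleSubst p) 1 w v ↔ v ∈ (imageLaw (nobleSubst p) w).support := by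
  rw [← zero_add 1, isImage_succ]; simp [isImage_zero]

lemma powMean_one (w : List Letter) : powMean p 1 w = wordMean p w := rfl

variable (p) in
lemma exists_isImage (k : ℕ) (w : List Letter) : ∃ v, IsImage (nobleSubst p) k w v :=
  (powLaw (nobleSubst p) k w).support_nonempty

end Means

/-! ### Lengths of images -/

section Lengths

variable (m : ℕ)

/-- The length of the images of a letter under the `k`-th power of the substitution. It does not
depend on the image, since all `a ^ i b a ^ (m - i)` have the same letters. -/
def letterLen : ℕ → Letter → ℕ
  | 0, _ => 1
  | k + 1, Letter.a => m * letterLen k Letter.a + letterLen k Letter.b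
  | k + 1, Letter.b => letterLen k Letter.a

/-- The length of the images of a word under the `k`-th power of the substitution. -/
def wordLen (k : ℕ) (w : List Letter) : ℕ := (w.map (letterLen m k)).sum

lemma wordLen_nil (k : ℕ) : wordLen m k [] = 0 := rfl

lemma wordLen_cons (k : ℕ) (x : Letter) (w : List Letter) :
    wordLen m k (x :: w) = letterLen m k x + wordLen m k w := by simp [wordLen]

lemma wordLen_append (k : ℕ) (u v : List Letter) :
    wordLen m k (u ++ v) = wordLen m k u + wordLen m k v := by simp [wordLen]

lemma wordLen_zero (w : List Letter) : wordLen m 0 w = w.length := by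
  induction w with
  | nil => rfl
  | cons x xs ih => rw [wordLen_cons, ih, List.length_cons]; simp [letterLen, add_comm]

lemma wordLen_singleton (k : ℕ) (x : Letter) : wordLen m k [x] = letterLen m k x := by
  simp [wordLen]

variable {m} {p : PMF (Fin (m + 1))}

lemma wordLen_of_mem_support_nobleSubst {k : ℕ} {x : Letter} {u : List Letter}
    (hu : u ∈ (nobleSubst p x).support) : wordLen m k u = letterLen m (k + 1) x := by
  cases x with
  | a =>
    obtain ⟨i, -, rfl⟩ := mem_support_nobleSubst_a.1 hu
    simp only [nobleWord, wordLen, letterLen, List.map_append, List.map_replicate, List.map_cons,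
      List.sum_append, List.sum_replicate, List.sum_cons, smul_eq_mul]
    have hi : (i : ℕ) ≤ m := Nat.lt_succ_iff.1 i.2
    obtain ⟨j, hj⟩ := Nat.exists_eq_add_of_le hi
    have hmul : m * letterLen m k Letter.a = (i + j) * letterLen m k Letter.a := by rw [← hj]
    rw [show m - (i : ℕ) = j by omega, hmul]
    ring
  | b => rw [mem_support_nobleSubst_b.1 hu]; simp [wordLen, letterLen]

lemma wordLen_of_mem_support_imageLaw {k : ℕ} {w v : List Letter}
    (hv : v ∈ (imageLaw (nobleSubst p) w).support) : wordLen m k v = wordLen m (k + 1) w := by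
  induction w generalizing v with
  | nil => rw [mem_support_imageLaw_nil.1 hv]; rfl
  | cons x xs ih =>
    obtain ⟨u, hu, u', hu', rfl⟩ := mem_support_imageLaw_cons.1 hv
    rw [wordLen_append, wordLen_cons, wordLen_of_mem_support_nobleSubst hu, ih hu']

lemma IsImage.wordLen_eq {j k : ℕ} {w v : List Letter} (hv : IsImage (nobleSubst p) k w v) :
    wordLen m j v = wordLen m (k + j) w := by
  induction k generalizing v j with
  | zero => rw [isImage_zero.1 hv, zero_add]
  | succ k ih =>
    obtain ⟨u, hu, huv⟩ := isImage_succ.1 hv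
    rw [wordLen_of_mem_support_imageLaw huv, ih hu]
    congr 1; omega

lemma IsImage.length_eq {k : ℕ} {w v : List Letter} (hv : IsImage (nobleSubst p) k w v) :
    v.length = wordLen m k w := by
  rw [← wordLen_zero m, hv.wordLen_eq, add_zero]

lemma length_of_mem_support_nobleSubst {x : Letter} {u : List Letter}
    (hu : u ∈ (nobleSubst p x).support) : u.length = letterLen m 1 x := by
  rw [← wordLen_zero m, wordLen_of_mem_support_nobleSubst hu]

variable (m) in
lemma letterLen_pos (k : ℕ) (x : Letter) : 1 ≤ letterLen m k x := by
  induction k generalizing x with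
  | zero => exact le_rfl
  | succ k ih =>
    cases x with
    | a => exact (ih Letter.b).trans (Nat.le_add_left _ _)
    | b => exact ih Letter.a

variable (m) in
lemma length_le_wordLen (k : ℕ) (w : List Letter) : w.length ≤ wordLen m k w := by
  induction w with
  | nil => exact Nat.zero_le _
  | cons x xs ih =>
    rw [wordLen_cons, List.length_cons]
    have := letterLen_pos m k x
    omega

variable (m)

/-- The inflation factor of the substitution. -/
noncomputable def inflation : ℝ := ((m : ℝ) + √((m : ℝ) ^ 2 + 4)) / 2

/-- The left Perron-Frobenius eigenvector of the substitution matrix on letters. -/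
noncomputable def letterWeight : Letter → ℝ
  | Letter.a => inflation m
  | Letter.b => 1

lemma inflation_sq : inflation m ^ 2 = m * inflation m + 1 := by
  have h := Real.sq_sqrt (show (0 : ℝ) ≤ (m : ℝ) ^ 2 + 4 by positivity)
  rw [inflation]
  linear_combination h / 4

variable {m}

lemma one_lt_inflation (hm : 1 ≤ m) : 1 < inflation m := by
  have h1 : (1 : ℝ) ≤ m := by exact_mod_cast hm
  have h2 : (2 : ℝ) < √((m : ℝ) ^ 2 + 4) := Real.lt_sqrt_of_sq_lt (by nlinarith)
  rw [inflation]; linarith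

lemma letterWeight_pos (hm : 1 ≤ m) (x : Letter) : 0 < letterWeight m x := by
  cases x with
  | a => exact zero_lt_one.trans (one_lt_inflation hm)
  | b => exact zero_lt_one

lemma letterLen_le (hm : 1 ≤ m) (k : ℕ) (x : Letter) :
    (letterLen m k x : ℝ) ≤ inflation m ^ k * letterWeight m x := by
  have h1 := one_lt_inflation hm
  have h2 := inflation_sq m
  induction k generalizing x with
  | zero => cases x <;> simp [letterLen, letterWeight, h1.le]
  | succ k ih =>
    have ha := ih Letter.a
    have hb := ih Letter.b
    simp only [letterWeight] at ha hb
    cases x with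
    | a =>
      simp only [letterLen, letterWeight]
      push_cast
      have : (m : ℝ) * letterLen m k Letter.a ≤ m * (inflation m ^ k * inflation m) :=
        mul_le_mul_of_nonneg_left ha (by positivity)
      calc _ ≤ m * (inflation m ^ k * inflation m) + inflation m ^ k * 1 := add_le_add this hb
        _ = inflation m ^ k * (m * inflation m + 1) := by ring
        _ = _ := by rw [← h2]; ring
    | b =>
      simp only [letterLen, letterWeight, mul_one]
      exact ha.trans_eq (pow_succ _ _).symm

lemma inflation_pow_le (hm : 1 ≤ m) (k : ℕ) (x : Letter) :
    inflation m ^ k * letterWeight m x ≤ inflation m * letterLen m k x := by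
  have h1 := one_lt_inflation hm
  have h2 := inflation_sq m
  induction k generalizing x with
  | zero => cases x <;> simp [letterLen, letterWeight, h1.le]
  | succ k ih =>
    have ha := ih Letter.a
    have hb := ih Letter.b
    simp only [letterWeight] at ha hb
    cases x with
    | a =>
      simp only [letterLen, letterWeight]
      push_cast
      have : (m : ℝ) * (inflation m ^ k * inflation m) ≤
          m * (inflation m * letterLen m k Letter.a) :=
        mul_le_mul_of_nonneg_left ha (by positivity)
      calc inflation m ^ (k + 1) * inflation m = inflation m ^ k * (m * inflation m + 1) := by
            rw [← h2]; ring
        _ = m * (inflation m ^ k * inflation m) + inflation m ^ k * 1 := by ring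
        _ ≤ _ := add_le_add this hb
        _ = _ := by ring
    | b =>
      simp only [letterLen, letterWeight, mul_one]
      exact (pow_succ _ _).trans_le ha

lemma inflation_pow_le_letterLen (hm : 1 ≤ m) (k : ℕ) (x : Letter) :
    inflation m ^ k ≤ inflation m * letterLen m k x := by
  have h1 := one_lt_inflation hm
  refine le_trans ?_ (inflation_pow_le hm k x)
  have : 1 ≤ letterWeight m x := by cases x <;> simp [letterWeight, h1.le]
  exact le_mul_of_one_le_right (by positivity) this

lemma tendsto_letterLen (hm : 1 ≤ m) (x : Letter) :
    Filter.Tendsto (fun k => letterLen m k x) Filter.atTop Filter.atTop := by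
  have h1 := one_lt_inflation hm
  rw [← tendsto_natCast_atTop_iff (R := ℝ)]
  have h2 := (tendsto_pow_atTop_atTop_of_one_lt h1).atTop_div_const (zero_lt_one.trans h1)
  refine Filter.tendsto_atTop_mono (fun k => ?_) h2
  rw [div_le_iff₀' (zero_lt_one.trans h1)]
  exact inflation_pow_le_letterLen hm k x

end Lengths

/-! ### Legal words -/

section Legal

variable {m : ℕ} {p : PMF (Fin (m + 1))}

lemma Legal.of_infix {u w : List Letter} (hw : Legal p w) (h : u <:+: w) : Legal p u := by
  obtain ⟨k, hk, v, hv, hwv⟩ := hw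
  exact ⟨k, hk, v, hv, h.trans hwv⟩

lemma Legal.of_isImage {j : ℕ} {w v : List Letter} (hw : Legal p w)
    (hv : IsImage (nobleSubst p) j w v) : Legal p v := by
  obtain ⟨k, hk, _, hw', s, t, rfl⟩ := hw
  obtain ⟨s', hs'⟩ := exists_isImage p j s
  obtain ⟨t', ht'⟩ := exists_isImage p j t
  exact ⟨k + j, by omega, s' ++ v ++ t', isImage_add.2 ⟨_, hw', isImage_append.2
    ⟨_, isImage_append.2 ⟨s', hs', v, hv, rfl⟩, t', ht', rfl⟩⟩, s', t', rfl⟩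

lemma exists_isImage_infix {j k : ℕ} {w v u : List Letter} {y : Letter}
    (hv : IsImage (nobleSubst p) j w v) (hy : y ∈ v) (hu : IsImage (nobleSubst p) k [y] u) :
    ∃ u', IsImage (nobleSubst p) (j + k) w u' ∧ u <:+: u' := by
  obtain ⟨s, t, rfl⟩ := List.append_of_mem hy
  obtain ⟨s', hs'⟩ := exists_isImage p k s
  obtain ⟨t', ht'⟩ := exists_isImage p k t
  refine ⟨s' ++ (u ++ t'), isImage_add.2 ⟨_, hv, isImage_append.2 ⟨s', hs', u ++ t', ?_, rfl⟩⟩,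
    s', t', by simp⟩
  exact isImage_append (w₁ := [y]).2 ⟨u, hu, t', ht', rfl⟩

lemma isImage_one_singleton {x : Letter} {u : List Letter} :
    IsImage (nobleSubst p) 1 [x] u ↔ u ∈ (nobleSubst p x).support := by
  rw [isImage_one, mem_support_imageLaw_cons]
  simp only [mem_support_imageLaw_nil, exists_eq_left, List.append_nil, exists_eq_right']

lemma isImage_one_b : IsImage (nobleSubst p) 1 [Letter.b] [Letter.a] := by
  rw [isImage_one_singleton, mem_support_nobleSubst_b]

lemma isImage_one_a (hp : ∀ i, 0 < p i) (i : Fin (m + 1)) :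
    IsImage (nobleSubst p) 1 [Letter.a] (nobleWord m i) := by
  rw [isImage_one_singleton, mem_support_nobleSubst_a]
  exact ⟨i, (hp i).ne', rfl⟩

/-- Always replacing `a` by `a ^ m b` gives images of `a` that start with `a ^ m b`. -/
lemma exists_isImage_prefix (hm : 1 ≤ m) (hp : ∀ i, 0 < p i) {k : ℕ} (hk : 1 ≤ k) :
    ∃ t, IsImage (nobleSubst p) k [Letter.a] (List.replicate m Letter.a ++ Letter.b :: t) := by
  have h1 : IsImage (nobleSubst p) 1 [Letter.a] (List.replicate m Letter.a ++ [Letter.b]) := by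
    simpa [nobleWord] using isImage_one_a hp (Fin.last m)
  induction k, hk using Nat.le_induction with
  | base => exact ⟨[], h1⟩
  | succ k hk ih =>
    obtain ⟨t, ht⟩ := ih
    obtain ⟨m', rfl⟩ : ∃ m', m = m' + 1 := ⟨m - 1, by omega⟩
    obtain ⟨t', ht'⟩ := exists_isImage p 1 (List.replicate m' Letter.a ++ Letter.b :: t)
    refine ⟨t', isImage_add.2 ⟨_, ht, ?_⟩⟩
    have := isImage_append (w₁ := [Letter.a]).2 ⟨_, h1, t', ht', rfl⟩
    simpa [List.replicate_succ] using this

lemma legal_of_isImage_a {k : ℕ} {v : List Letter} (hv : IsImage (nobleSubst p) k [Letter.a] v) :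
    Legal p v :=
  ⟨1 + k, by omega, v, isImage_add.2 ⟨_, isImage_one_b, hv⟩, List.infix_rfl⟩

/-- Each legal word occurs in images of `a` under all large powers, at a fixed position. -/
lemma Legal.exists_prefix (hm : 1 ≤ m) (hp : ∀ i, 0 < p i) {w : List Letter} (hw : Legal p w) :
    ∃ s : List Letter, ∃ K : ℕ, ∀ k, K ≤ k →
      ∃ t, IsImage (nobleSubst p) k [Letter.a] (s ++ w ++ t) := by
  obtain ⟨k₀, hk₀, _, hv, s₀, t₀, rfl⟩ := hw
  obtain ⟨s₁, hs₁⟩ := exists_isImage p k₀ (List.replicate m Letter.a)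
  refine ⟨s₁ ++ s₀, 1 + k₀, fun k hk => ?_⟩
  obtain ⟨j, rfl⟩ := Nat.exists_eq_add_of_le hk
  obtain ⟨t, ht⟩ := exists_isImage_prefix hm hp (k := 1 + j) (by omega)
  obtain ⟨t₁, ht₁⟩ := exists_isImage p k₀ t
  refine ⟨t₀ ++ t₁, ?_⟩
  rw [show 1 + k₀ + j = 1 + j + k₀ by omega]
  refine isImage_add.2 ⟨_, ht, isImage_append.2 ⟨s₁, hs₁, s₀ ++ w ++ t₀ ++ t₁, ?_, by simp⟩⟩
  exact isImage_append (w₁ := [Letter.b]).2 ⟨_, hv, t₁, ht₁, rfl⟩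

/-- This is what makes the induced substitution matrix primitive. -/
lemma Legal.exists_isImage_infix (hm : 1 ≤ m) (hp : ∀ i, 0 < p i) {w : List Letter}
    (hw : Legal p w) :
    ∃ K : ℕ, ∀ k, K ≤ k → ∀ x, ∃ v, IsImage (nobleSubst p) k [x] v ∧ w <:+: v := by
  obtain ⟨s, K, hK⟩ := hw.exists_prefix hm hp
  refine ⟨1 + K, fun k hk x => ?_⟩
  cases x with
  | a =>
    obtain ⟨t, ht⟩ := hK k (by omega)
    exact ⟨_, ht, s, t, rfl⟩
  | b =>
    obtain ⟨j, rfl⟩ := Nat.exists_eq_add_of_le hk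
    obtain ⟨t, ht⟩ := hK (K + j) (by omega)
    rw [add_assoc]
    exact ⟨_, isImage_add.2 ⟨_, isImage_one_b, ht⟩, s, t, rfl⟩

/-- Both letters are the first letters of arbitrarily long legal words. -/
lemma exists_legal_cons (hm : 1 ≤ m) (hp : ∀ i, 0 < p i) (x : Letter) (n : ℕ) :
    ∃ w : List Letter, w.length = n ∧ Legal p (x :: w) := by
  have key : ∃ v : List Letter, n ≤ v.length ∧ Legal p (x :: v) := by
    have hlen : ∃ k, 1 ≤ k ∧ n + 1 ≤ letterLen m k Letter.a :=
      ((Filter.eventually_ge_atTop 1).and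
        ((tendsto_letterLen hm Letter.a).eventually_ge_atTop (n + 1))).exists
    obtain ⟨k, hk, hkn⟩ := hlen
    obtain ⟨t, ht⟩ := exists_isImage_prefix hm hp hk
    obtain ⟨m', hm'⟩ : ∃ m', m = m' + 1 := ⟨m - 1, by omega⟩
    obtain ⟨t₁, ht₁⟩ : ∃ t₁, List.replicate m Letter.a ++ Letter.b :: t = Letter.a :: t₁ := by
      rw [hm']; exact ⟨_, rfl⟩
    rw [ht₁] at ht
    have hlt := ht.length_eq
    rw [wordLen_singleton, List.length_cons] at hlt
    cases x with
    | a => exact ⟨t₁, by omega, legal_of_isImage_a ht⟩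
    | b =>
      obtain ⟨t₂, ht₂⟩ := exists_isImage p 1 t₁
      have h0 : IsImage (nobleSubst p) 1 [Letter.a] (Letter.b :: List.replicate m Letter.a) := by
        simpa [nobleWord] using isImage_one_a hp 0
      refine ⟨List.replicate m Letter.a ++ t₂, ?_, (legal_of_isImage_a ht).of_isImage (j := 1)
        (isImage_append (w₁ := [Letter.a]).2 ⟨_, h0, t₂, ht₂, rfl⟩)⟩
      have h1 := ht₂.length_eq
      have h2 := length_le_wordLen m 1 t₁
      simp only [List.length_append, List.length_replicate]
      omega
  obtain ⟨v, hv, hleg⟩ := key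
  exact ⟨v.take n, by simpa using hv, hleg.of_infix
    (List.prefix_iff_eq_take.2 (by simp [hv]) : x :: v.take n <+: x :: v).isInfix⟩

lemma legal_aa (hm : 1 ≤ m) (hp : ∀ i, 0 < p i) : Legal p [Letter.a, Letter.a] := by
  have h0 : IsImage (nobleSubst p) 1 [Letter.a] ([Letter.b] ++ List.replicate m Letter.a) := by
    simpa [nobleWord] using isImage_one_a hp 0
  have h1 : IsImage (nobleSubst p) 1 [Letter.a] (List.replicate m Letter.a ++ [Letter.b]) := by
    simpa [nobleWord] using isImage_one_a hp (Fin.last m)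
  obtain ⟨m', rfl⟩ : ∃ m', m = m' + 1 := ⟨m - 1, by omega⟩
  obtain ⟨t, ht⟩ := exists_isImage p 1 (List.replicate m' Letter.a)
  have h2 : IsImage (nobleSubst p) 1 ([Letter.b] ++ List.replicate (m' + 1) Letter.a)
      ([Letter.a] ++ ((List.replicate (m' + 1) Letter.a ++ [Letter.b]) ++ t)) :=
    isImage_append.2 ⟨_, isImage_one_b, _,
      isImage_append (w₁ := [Letter.a]).2 ⟨_, h1, t, ht, rfl⟩, rfl⟩
  refine (((legal_of_isImage_a h0).of_isImage h2)).of_infix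
    ⟨[], List.replicate m' Letter.a ++ [Letter.b] ++ t, ?_⟩
  simp [List.replicate_succ]

lemma nonempty_legalWord (hm : 1 ≤ m) (hp : ∀ i, 0 < p i) (ℓ : ℕ) : Nonempty (LegalWord p ℓ) := by
  obtain ⟨w, hw, hleg⟩ := exists_legal_cons hm hp Letter.a ℓ
  exact ⟨⟨w, hleg.of_infix ⟨[Letter.a], [], by simp⟩, hw⟩⟩

end Legal

/-! ### Sums over the windows of a word -/

section Windows

/-- The sum of `g` over the windows of length `ℓ` of the word `v` that start at the positions
`0, …, n - 1`. The windows at the end of `v` may be shorter than `ℓ`. -/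
def windowSum (g : List Letter → ℝ) (ℓ n : ℕ) (v : List Letter) : ℝ :=
  ∑ j ∈ Finset.range n, g ((v.drop j).take ℓ)

variable (g : List Letter → ℝ) (ℓ : ℕ)

lemma take_drop_append {ℓ j : ℕ} {u : List Letter} (h : j + ℓ ≤ u.length) (v : List Letter) :
    ((u ++ v).drop j).take ℓ = (u.drop j).take ℓ := by
  rw [List.drop_append_of_le_length (by omega), List.take_append_of_le_length (by simp; omega)]

lemma windowSum_append_left {n : ℕ} {u : List Letter} (h : n + ℓ ≤ u.length + 1)
    (v : List Letter) : windowSum g ℓ n (u ++ v) = windowSum g ℓ n u := by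
  refine Finset.sum_congr rfl fun j hj => ?_
  rw [Finset.mem_range] at hj
  rw [take_drop_append (by omega)]

lemma windowSum_add (n₁ n₂ : ℕ) (u v : List Letter) (hu : u.length = n₁) :
    windowSum g ℓ (n₁ + n₂) (u ++ v) = windowSum g ℓ n₁ (u ++ v) + windowSum g ℓ n₂ v := by
  rw [windowSum, Finset.sum_range_add]
  congr 1
  refine Finset.sum_congr rfl fun j _ => ?_
  rw [← hu, ← List.drop_drop, List.drop_left]

variable {m : ℕ} (p : PMF (Fin (m + 1)))

/-- The expected sum of `g` over the windows of length `ℓ` that start in the image of the first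
letter of `w` under the `k`-th power. -/
noncomputable def inducedMean (k : ℕ) (w : List Letter) : ℝ :=
  powMean p k w (windowSum g ℓ (wordLen m k (w.take 1)))

/-- The windows starting in the image of one letter only see the images of this letter and of the
next `ℓ - 1` letters. -/
lemma wordMean_windowSum (hℓ : 1 ≤ ℓ) (N : ℕ) (v : List Letter) (h : N + ℓ ≤ v.length + 1) :
    wordMean p v (windowSum g ℓ (wordLen m 1 (v.take N))) =
      windowSum (inducedMean g ℓ p 1) ℓ N v := by
  induction N generalizing v with
  | zero =>
    have : windowSum g ℓ 0 = fun _ => 0 := by ext; simp [windowSum]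
    simp only [List.take_zero, wordLen_nil, this, wordMean_const]
    simp [windowSum]
  | succ N ih =>
    cases v with
    | nil => simp at h; omega
    | cons x xs =>
      rw [List.length_cons] at h
      have h1 : wordMean p (x :: xs) (windowSum g ℓ (wordLen m 1 ((x :: xs).take (N + 1)))) =
          wordMean p (x :: xs) (windowSum g ℓ (letterLen m 1 x)) +
            wordMean p xs (windowSum g ℓ (wordLen m 1 (xs.take N))) := by
        rw [wordMean_cons, wordMean_cons, List.take_succ_cons, wordLen_cons]
        rw [← letterMean_const p x (wordMean p xs _), ← map_add]
        refine letterMean_congr fun u hu => ?_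
        rw [Pi.add_apply, ← map_add]
        congr 1
        ext v
        rw [Pi.add_apply, windowSum_add _ _ _ _ _ _ (length_of_mem_support_nobleSubst hu)]
      have h2 : wordMean p (x :: xs) (windowSum g ℓ (letterLen m 1 x)) =
          inducedMean g ℓ p 1 ((x :: xs).take ℓ) := by
        obtain ⟨ℓ', rfl⟩ : ∃ ℓ', ℓ = ℓ' + 1 := ⟨ℓ - 1, by omega⟩
        conv_lhs => rw [← List.take_append_drop (ℓ' + 1) (x :: xs), wordMean_append]
        rw [inducedMean, powMean_one, List.take_take, min_eq_left (by omega),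
          show (x :: xs).take 1 = [x] from rfl, wordLen_singleton]
        refine wordMean_congr fun u hu => ?_
        rw [← wordMean_const p ((x :: xs).drop (ℓ' + 1)) (windowSum g (ℓ' + 1) (letterLen m 1 x) u)]
        congr 1
        ext v
        refine windowSum_append_left _ _ ?_ _
        have h3 := (isImage_one.2 hu).length_eq
        rw [List.take_succ_cons, wordLen_cons] at h3
        have h4 := length_le_wordLen m 1 (xs.take ℓ')
        rw [List.length_take] at h4
        omega
      rw [h1, h2, ih xs (by omega), windowSum, windowSum, Finset.sum_range_succ', add_comm]
      simp

lemma inducedMean_zero {w : List Letter} (hw : w.length = ℓ) (hℓ : 1 ≤ ℓ) :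
    inducedMean g ℓ p 0 w = g w := by
  rw [inducedMean, powMean_zero, wordLen_zero, List.length_take, hw, min_eq_left hℓ, windowSum,
    Finset.sum_range_one, List.drop_zero, ← hw, List.take_length]

lemma inducedMean_succ (hℓ : 1 ≤ ℓ) (k : ℕ) {w : List Letter} (hw : w.length = ℓ) :
    inducedMean g ℓ p (k + 1) w = inducedMean (inducedMean g ℓ p 1) ℓ p k w := by
  rw [inducedMean, powMean_succ, inducedMean]
  refine powMean_congr fun v hv => ?_
  have hv' := hv
  rw [← List.take_append_drop 1 w, isImage_append] at hv'
  obtain ⟨v₁, h₁, v₂, h₂, rfl⟩ := hv'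
  have hl := hv.length_eq
  have hl₁ := h₁.length_eq
  have hl₂ := h₂.length_eq
  rw [← wordMean_windowSum g ℓ p hℓ]
  · rw [← h₁.wordLen_eq, List.take_left' hl₁]
  · have := length_le_wordLen m k (w.drop 1)
    rw [List.length_drop] at this
    rw [List.length_append]
    omega

end Windows

/-! ### The induced substitution matrix -/

section InducedMatrix

open Matrix

variable {m : ℕ} {p : PMF (Fin (m + 1))}

lemma tsum_bind_mul {α β : Type} (q : PMF α) (f : α → PMF β) (F : β → ℝ≥0∞) :
    ∑' b, (q.bind f) b * F b = ∑' a, q a * ∑' b, f a b * F b := by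
  simp only [PMF.bind_apply, ← ENNReal.tsum_mul_right, ← ENNReal.tsum_mul_left]
  rw [ENNReal.tsum_comm]
  simp only [mul_assoc]

lemma tsum_pure_mul {β : Type} (b : β) (F : β → ℝ≥0∞) :
    ∑' b', (PMF.pure b) b' * F b' = F b := by
  rw [tsum_eq_single b fun b' hb' => by simp [PMF.pure_apply, hb']]
  simp

lemma tsum_nobleSubst_mul (x : Letter) {f : List Letter → ℝ} (hf : ∀ u, 0 ≤ f u) :
    ∑' u, nobleSubst p x u * ENNReal.ofReal (f u) = ENNReal.ofReal (letterMean p x f) := by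
  cases x with
  | a =>
    rw [letterMean_a, nobleSubst, PMF.map, tsum_bind_mul, tsum_fintype,
      ENNReal.ofReal_sum_of_nonneg fun i _ => mul_nonneg ENNReal.toReal_nonneg (hf _)]
    refine Finset.sum_congr rfl fun i _ => ?_
    rw [Function.comp, tsum_pure_mul, ENNReal.ofReal_mul ENNReal.toReal_nonneg,
      ENNReal.ofReal_toReal (p.apply_ne_top i)]
  | b => rw [nobleSubst, tsum_pure_mul, letterMean_b]

lemma tsum_imageLaw_mul (w : List Letter) {f : List Letter → ℝ} (hf : ∀ u, 0 ≤ f u) :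
    ∑' u, imageLaw (nobleSubst p) w u * ENNReal.ofReal (f u) =
      ENNReal.ofReal (wordMean p w f) := by
  induction w generalizing f with
  | nil => rw [imageLaw, tsum_pure_mul, wordMean_nil]
  | cons x xs ih =>
    rw [imageLaw, tsum_bind_mul, wordMean_cons,
      ← tsum_nobleSubst_mul x fun u => wordMean_nonneg fun v => hf _]
    refine tsum_congr fun u => ?_
    rw [tsum_bind_mul, ← ih fun v => hf _]
    simp only [tsum_pure_mul]

/-- The indicator function of a word. -/
def wordIndicator (u w : List Letter) : ℝ := if w = u then 1 else 0

lemma wordIndicator_nonneg (u w : List Letter) : 0 ≤ wordIndicator u w := by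
  unfold wordIndicator; split_ifs <;> norm_num

lemma count_map_range [BEq (List Letter)] [LawfulBEq (List Letter)] (u v : List Letter) (ℓ n : ℕ) :
    ((((List.range n).map fun k => (v.drop k).take ℓ).count u : ℕ) : ℝ) =
      windowSum (wordIndicator u) ℓ n v := by
  induction n with
  | zero => simp [windowSum]
  | succ n ih =>
    rw [List.range_succ, List.map_append, List.count_append, Nat.cast_add, ih, windowSum, windowSum,
      Finset.sum_range_succ]
    congr 1
    simp [wordIndicator, List.count_singleton]

lemma windowSum_nonneg {g : List Letter → ℝ} (hg : ∀ u, 0 ≤ g u) (ℓ n : ℕ) (v : List Letter) :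
    0 ≤ windowSum g ℓ n v :=
  Finset.sum_nonneg fun _ _ => hg _

lemma inducedMatrix_apply {ℓ : ℕ} (hℓ : 1 ≤ ℓ) (u w : LegalWord p ℓ) :
    inducedMatrix p ℓ u w = inducedMean (wordIndicator u.1) ℓ p 1 w.1 := by
  obtain ⟨w, hw, hwl⟩ := w
  cases w with
  | nil => simp at hwl; omega
  | cons x xs =>
    have hnn : ∀ v, 0 ≤ windowSum (wordIndicator u.1) ℓ (letterLen m 1 x) v :=
      windowSum_nonneg (wordIndicator_nonneg _) _ _
    have hsum : ∑' W, inducedSubst (nobleSubst p) ℓ (x :: xs) W *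
        (@List.count _ instBEqOfDecidableEq u.1 W : ℝ≥0∞) =
        ENNReal.ofReal
          (wordMean p (x :: xs) (windowSum (wordIndicator u.1) ℓ (letterLen m 1 x))) := by
      rw [inducedSubst, tsum_bind_mul, wordMean_cons,
        ← tsum_nobleSubst_mul x fun u => wordMean_nonneg fun v => hnn _]
      refine tsum_congr fun v₁ => ?_
      by_cases hv₁ : v₁ ∈ (nobleSubst p x).support
      · rw [tsum_bind_mul, ← tsum_imageLaw_mul xs fun v => hnn _]
        simp only [tsum_pure_mul]
        congr 2
        ext v
        rw [← length_of_mem_support_nobleSubst hv₁, ← @count_map_range instBEqOfDecidableEq _,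
          ENNReal.ofReal_natCast]
      · rw [PMF.mem_support_iff, not_not] at hv₁
        rw [hv₁, zero_mul, zero_mul]
    rw [inducedMatrix, submatrix_apply, substMatrix, of_apply]
    dsimp only
    rw [hsum,
      ENNReal.toReal_ofReal (wordMean_nonneg hnn), inducedMean, powMean_one, List.take_succ_cons,
      List.take_zero, wordLen_singleton]

lemma legal_window {k ℓ j : ℕ} {w v : List Letter} (hw : Legal p w) (hwl : w.length = ℓ)
    (hℓ : 1 ≤ ℓ) (hv : IsImage (nobleSubst p) k w v) (hj : j < wordLen m k (w.take 1)) :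
    Legal p ((v.drop j).take ℓ) ∧ ((v.drop j).take ℓ).length = ℓ := by
  refine ⟨(hw.of_isImage hv).of_infix
    ((List.take_prefix _ _).isInfix.trans (List.drop_suffix _ _).isInfix), ?_⟩
  have h1 := hv.length_eq
  rw [← List.take_append_drop 1 w, wordLen_append] at h1
  have h2 := length_le_wordLen m k (w.drop 1)
  rw [List.length_drop] at h2
  rw [List.length_take, List.length_drop]
  omega

lemma sum_legalWord_mul_wordIndicator {ℓ : ℕ} (g : List Letter → ℝ) {v : List Letter}
    (hv : Legal p v) (hvl : v.length = ℓ) :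
    ∑ u : LegalWord p ℓ, g u.1 * wordIndicator u.1 v = g v := by
  rw [Finset.sum_eq_single (⟨v, hv, hvl⟩ : LegalWord p ℓ)]
  · simp [wordIndicator]
  · intro u _ hu
    have : v ≠ u.1 := fun h => hu (Subtype.ext h.symm)
    simp [wordIndicator, this]
  · intro h; exact absurd (Finset.mem_univ _) h

lemma vecMul_inducedMatrix {ℓ : ℕ} (hℓ : 1 ≤ ℓ) (g : List Letter → ℝ) :
    (fun u : LegalWord p ℓ => g u.1) ᵥ* inducedMatrix p ℓ = fun w => inducedMean g ℓ p 1 w.1 := by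
  ext w
  have h1 : ((fun u : LegalWord p ℓ => g u.1) ᵥ* inducedMatrix p ℓ) w =
      powMean p 1 w.1 (∑ u : LegalWord p ℓ,
        g u.1 • windowSum (wordIndicator u.1) ℓ (wordLen m 1 (w.1.take 1))) := by
    rw [map_sum]
    refine Finset.sum_congr rfl fun u _ => ?_
    rw [map_smul, smul_eq_mul]
    exact congrArg (g u.1 * ·) (inducedMatrix_apply hℓ u w)
  rw [h1, inducedMean]
  refine powMean_congr fun v hv => ?_
  simp only [Finset.sum_apply, Pi.smul_apply, smul_eq_mul, windowSum, Finset.mul_sum]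
  rw [Finset.sum_comm]
  refine Finset.sum_congr rfl fun j hj => ?_
  obtain ⟨h2, h3⟩ := legal_window w.2.1 w.2.2 hℓ hv (Finset.mem_range.1 hj)
  exact sum_legalWord_mul_wordIndicator g h2 h3

/-- The powers of the induced substitution matrix count the windows in images under the powers of
the substitution. -/
lemma vecMul_inducedMatrix_pow {ℓ : ℕ} (hℓ : 1 ≤ ℓ) (k : ℕ) (g : List Letter → ℝ) :
    (fun u : LegalWord p ℓ => g u.1) ᵥ* inducedMatrix p ℓ ^ k =
      fun w => inducedMean g ℓ p k w.1 := by
  induction k generalizing g with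
  | zero =>
    rw [pow_zero, vecMul_one]
    ext w
    rw [inducedMean_zero g ℓ p w.2.2 hℓ]
  | succ k ih =>
    rw [pow_succ', ← vecMul_vecMul, vecMul_inducedMatrix hℓ, ih]
    ext w
    rw [inducedMean_succ g ℓ p hℓ k w.2.2]

lemma inducedMatrix_pow_apply {ℓ : ℕ} (hℓ : 1 ≤ ℓ) (k : ℕ) (u w : LegalWord p ℓ) :
    (inducedMatrix p ℓ ^ k) u w = inducedMean (wordIndicator u.1) ℓ p k w.1 := by
  have h1 := congrFun (vecMul_inducedMatrix_pow (p := p) hℓ k (wordIndicator u.1)) w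
  rw [← h1]
  have h2 : (fun v : LegalWord p ℓ => wordIndicator u.1 v.1) = Pi.single u 1 := by
    ext v
    simp only [wordIndicator, Pi.single_apply, Subtype.ext_iff]
  rw [h2, single_one_vecMul]; rfl

lemma isPrimitive_inducedMatrix (hm : 1 ≤ m) (hp : ∀ i, 0 < p i) {ℓ : ℕ} (hℓ : 1 ≤ ℓ) :
    (inducedMatrix p ℓ).IsPrimitive := by
  refine ⟨fun u w => ?_, ?_⟩
  · rw [inducedMatrix_apply hℓ]
    exact powMean_nonneg (windowSum_nonneg (wordIndicator_nonneg _) _ _)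
  · choose K hK using fun u : LegalWord p ℓ => u.2.1.exists_isImage_infix hm hp
    refine ⟨∑ u, K u + 1, Nat.succ_pos _, fun u w => ?_⟩
    set N := ∑ u, K u + 1
    have hN : K u ≤ N := (Finset.single_le_sum (fun _ _ => Nat.zero_le _)
      (Finset.mem_univ u)).trans (Nat.le_succ _)
    rw [inducedMatrix_pow_apply hℓ]
    obtain ⟨w, hw, hwl⟩ := w
    cases w with
    | nil => simp at hwl; omega
    | cons x xs =>
      obtain ⟨_, hv, s, t, rfl⟩ := hK u N hN x
      obtain ⟨v', hv'⟩ := exists_isImage p N xs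
      have himg := isImage_append (w₁ := [x]).2 ⟨_, hv, v', hv', rfl⟩
      refine powMean_pos (windowSum_nonneg (wordIndicator_nonneg _) _ _) himg ?_
      refine Finset.sum_pos' (fun j _ => wordIndicator_nonneg _ _)
        ⟨s.length, Finset.mem_range.2 ?_, ?_⟩
      · rw [List.take_succ_cons, List.take_zero, ← hv.length_eq, List.length_append,
          List.length_append, u.2.2]
        omega
      · have : (List.drop s.length (s ++ u.1 ++ t ++ v')).take ℓ = u.1 := by
          rw [List.append_assoc, List.append_assoc, List.drop_left, List.take_left' u.2.2]
        rw [this]; simp [wordIndicator]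

/-- The letter weights, read off the first letter of a word, are a left eigenvector of the induced
substitution matrix for the inflation factor. -/
lemma vecMul_inducedMatrix_letterWeight {ℓ : ℕ} (hℓ : 1 ≤ ℓ) :
    (fun u : LegalWord p ℓ => ((u.1.take 1).map (letterWeight m)).sum) ᵥ* inducedMatrix p ℓ =
      inflation m • fun u : LegalWord p ℓ => ((u.1.take 1).map (letterWeight m)).sum := by
  rw [vecMul_inducedMatrix hℓ fun u => ((u.take 1).map (letterWeight m)).sum]
  have hws : ∀ (n : ℕ) (v v' : List Letter), v.length = n →
      windowSum (fun u => ((u.take 1).map (letterWeight m)).sum) ℓ n (v ++ v') =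
        (v.map (letterWeight m)).sum := by
    intro n v v' hv
    induction v generalizing n with
    | nil => rw [← hv]; simp [windowSum]
    | cons y ys ih =>
      rw [← hv, List.length_cons, windowSum, Finset.sum_range_succ', List.map_cons, List.sum_cons,
        ← ih _ rfl, add_comm, windowSum]
      congr 1
      obtain ⟨ℓ', rfl⟩ : ∃ ℓ', ℓ = ℓ' + 1 := ⟨ℓ - 1, by omega⟩
      simp
  ext ⟨w, hw, hwl⟩
  cases w with
  | nil => simp at hwl; omega
  | cons x xs =>
    rw [inducedMean, powMean_one, wordMean_cons, Pi.smul_apply, List.take_succ_cons, List.take_zero,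
      wordLen_singleton, List.map_singleton, List.sum_singleton, smul_eq_mul,
      ← letterMean_const p x (inflation m * letterWeight m x)]
    refine letterMean_congr fun u hu => ?_
    simp only [hws _ u _ (length_of_mem_support_nobleSubst hu), wordMean_const]
    have hsq := inflation_sq m
    cases x with
    | a =>
      obtain ⟨i, -, rfl⟩ := mem_support_nobleSubst_a.1 hu
      simp only [nobleWord, List.map_append, List.map_replicate, List.map_cons,
        List.sum_append, List.sum_replicate, List.sum_cons, nsmul_eq_mul, letterWeight]
      rw [Nat.cast_sub (Nat.lt_succ_iff.1 i.2)]
      linear_combination -hsq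
    | b => rw [mem_support_nobleSubst_b.1 hu]; simp [letterWeight]

lemma sum_letterWeight_take_one_pos (hm : 1 ≤ m) {ℓ : ℕ} (hℓ : 1 ≤ ℓ) (u : LegalWord p ℓ) :
    0 < ((u.1.take 1).map (letterWeight m)).sum := by
  obtain ⟨w, hw, hwl⟩ := u
  cases w with
  | nil => simp at hwl; omega
  | cons x xs => simpa using letterWeight_pos hm x

lemma existsUnique_isRightPF_inducedMatrix (hm : 1 ≤ m) (hp : ∀ i, 0 < p i) {ℓ : ℕ} (hℓ : 1 ≤ ℓ) :
    ∃! R, IsRightPF (inducedMatrix p ℓ) R :=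
  have := nonempty_legalWord hm hp ℓ
  existsUnique_isRightPF (isPrimitive_inducedMatrix hm hp hℓ)
    (zero_lt_one.trans (one_lt_inflation hm)) (sum_letterWeight_take_one_pos hm hℓ)
    (vecMul_inducedMatrix_letterWeight hℓ)

lemma IsRightPF.mulVec_eq (hm : 1 ≤ m) (hp : ∀ i, 0 < p i) {ℓ : ℕ} (hℓ : 1 ≤ ℓ)
    {R : LegalWord p ℓ → ℝ} (hR : IsRightPF (inducedMatrix p ℓ) R) :
    inducedMatrix p ℓ *ᵥ R = inflation m • R := by
  have := nonempty_legalWord hm hp ℓ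
  rw [hR.1, spectralRadius_eq_of_vecMul_eq (isPrimitive_inducedMatrix hm hp hℓ).nonneg
    (zero_lt_one.trans (one_lt_inflation hm)) (sum_letterWeight_take_one_pos hm hℓ)
    (vecMul_inducedMatrix_letterWeight hℓ)]

end InducedMatrix

/-! ### Word frequencies in images of letters -/

section Frequencies

open Filter Topology Matrix

variable {φ : List Letter → ℝ} {B : ℝ} {ℓ : ℕ}

lemma abs_sum_range_shift_sub_le {Φ : ℕ → ℝ} (hΦ : ∀ i, |Φ i| ≤ B) (j n : ℕ) :
    |∑ i ∈ Finset.range n, Φ (j + i) - ∑ i ∈ Finset.range n, Φ i| ≤ 2 * (j * B) := by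
  have h1 := Finset.sum_range_add Φ j n
  have h2 := Finset.sum_range_add Φ n j
  rw [add_comm n j] at h2
  have h3 : |∑ i ∈ Finset.range j, Φ (n + i)| ≤ j * B := by
    simpa using Finset.abs_sum_le_sum_abs _ _ |>.trans
      (Finset.sum_le_card_nsmul (Finset.range j) (fun i => |Φ (n + i)|) B fun i _ => hΦ _)
  have h4 : |∑ i ∈ Finset.range j, Φ i| ≤ j * B := by
    simpa using Finset.abs_sum_le_sum_abs _ _ |>.trans
      (Finset.sum_le_card_nsmul (Finset.range j) (fun i => |Φ i|) B fun i _ => hΦ _)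
  rw [abs_le] at *
  constructor <;> linarith [h3.1, h3.2, h4.1, h4.2]

lemma abs_windowSum_le (hφ : ∀ u, |φ u| ≤ B) (ℓ n : ℕ) (v : List Letter) :
    |windowSum φ ℓ n v| ≤ n * B := by
  unfold windowSum
  simpa using Finset.abs_sum_le_sum_abs _ _ |>.trans
    (Finset.sum_le_card_nsmul (Finset.range n) (fun j => |φ ((v.drop j).take ℓ)|) B fun i _ => hφ _)

lemma abs_windowSum_add_sub_le (hφ : ∀ u, |φ u| ≤ B) (ℓ n k : ℕ) (v : List Letter) :
    |windowSum φ ℓ (n + k) v - windowSum φ ℓ n v| ≤ k * B := by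
  rw [windowSum, windowSum, Finset.sum_range_add, add_sub_cancel_left]
  simpa using Finset.abs_sum_le_sum_abs _ _ |>.trans
    (Finset.sum_le_card_nsmul (Finset.range k) (fun j => |φ ((v.drop (n + j)).take ℓ)|) B
      fun i _ => hφ _)

variable (φ ℓ) in
/-- The sum of `φ` over the windows of length `ℓ` that start in `u`, the last ones cut off at the
end of `u`. -/
def fullSum (u : List Letter) : ℝ := windowSum φ ℓ u.length u

lemma fullSum_nil : fullSum φ ℓ [] = 0 := by simp [fullSum, windowSum]

/-- Appending a word only changes the windows near the end. -/
lemma abs_windowSum_append_sub_le (hφ : ∀ u, |φ u| ≤ B) (u v : List Letter) :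
    |windowSum φ ℓ u.length (u ++ v) - fullSum φ ℓ u| ≤ 2 * B * ℓ := by
  have hB : 0 ≤ B := (abs_nonneg _).trans (hφ [])
  rw [fullSum, windowSum, windowSum, ← Finset.sum_sub_distrib]
  refine (Finset.abs_sum_le_sum_abs _ _).trans ?_
  calc ∑ j ∈ Finset.range u.length,
        |φ (((u ++ v).drop j).take ℓ) - φ ((u.drop j).take ℓ)|
      ≤ ∑ j ∈ Finset.range u.length, if u.length < j + ℓ then 2 * B else 0 := by
        refine Finset.sum_le_sum fun j _ => ?_
        split_ifs with h
        · have h1 := hφ (((u ++ v).drop j).take ℓ)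
          have h2 := hφ ((u.drop j).take ℓ)
          exact (abs_sub _ _).trans (by linarith)
        · rw [take_drop_append (not_lt.1 h), sub_self, abs_zero]
    _ = ((Finset.range u.length).filter fun j => u.length < j + ℓ).card * (2 * B) := by
        rw [← Finset.sum_filter, Finset.sum_const, nsmul_eq_mul]
    _ ≤ ℓ * (2 * B) := by
        refine mul_le_mul_of_nonneg_right ?_ (by positivity)
        have : ((Finset.range u.length).filter fun j => u.length < j + ℓ) ⊆
            Finset.Ico (u.length - ℓ) u.length := fun j hj => by
          simp only [Finset.mem_filter, Finset.mem_range] at hj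
          rw [Finset.mem_Ico]; omega
        have h2 := Finset.card_le_card this
        rw [Nat.card_Ico] at h2
        exact_mod_cast h2.trans (by omega)
    _ = 2 * B * ℓ := by ring

lemma abs_fullSum_append_sub_le (hφ : ∀ u, |φ u| ≤ B) (u v : List Letter) :
    |fullSum φ ℓ (u ++ v) - (fullSum φ ℓ u + fullSum φ ℓ v)| ≤ 2 * B * ℓ := by
  have h : fullSum φ ℓ (u ++ v) = windowSum φ ℓ u.length (u ++ v) + fullSum φ ℓ v := by
    rw [fullSum, List.length_append, windowSum_add _ _ _ _ _ _ rfl, fullSum]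
  rw [h, add_sub_add_right_eq_sub]
  exact abs_windowSum_append_sub_le hφ u v

variable {m : ℕ} {p : PMF (Fin (m + 1))}

/-- If `φ` has mean zero for the Perron-Frobenius eigenvector, then the expected sum of `φ` over
the windows of an image of a letter is of smaller order than the length of the image. -/
lemma tendsto_powMean_fullSum (hm : 1 ≤ m) (hp : ∀ i, 0 < p i) (hℓ : 1 ≤ ℓ)
    {R : LegalWord p ℓ → ℝ} (hR : IsRightPF (inducedMatrix p ℓ) R) (hφ : ∀ u, |φ u| ≤ B)
    (h0 : ∑ w : LegalWord p ℓ, φ w.1 * R w = 0) (x : Letter) :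
    Tendsto (fun k => powMean p k [x] (fullSum φ ℓ) / inflation m ^ k) atTop (𝓝 0) := by
  have h1 := one_lt_inflation hm
  have h1' : 0 < inflation m := by linarith
  obtain ⟨xs, hxs, hleg⟩ := exists_legal_cons hm hp x (ℓ - 1)
  set w : LegalWord p ℓ := ⟨x :: xs, hleg, by rw [List.length_cons]; omega⟩ with hw
  have h2 := tendsto_vecMul_pow_div (isPrimitive_inducedMatrix hm hp hℓ) h1' hR.2.1
    (hR.mulVec_eq hm hp hℓ) (φ := fun u => φ u.1) h0 w
  simp only [vecMul_inducedMatrix_pow hℓ] at h2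
  have h3 : ∀ k, |powMean p k [x] (fullSum φ ℓ) - inducedMean φ ℓ p k w.1| ≤ 2 * B * ℓ := by
    intro k
    have h6 : inducedMean φ ℓ p k w.1 = powMean p k [x] fun u => powMean p k xs fun v =>
        windowSum φ ℓ (wordLen m k [x]) (u ++ v) := by
      rw [inducedMean, ← powMean_cons]; rfl
    rw [h6, ← map_sub]
    refine abs_powMean_le fun u hu => ?_
    rw [Pi.sub_apply, ← powMean_const p k xs (fullSum φ ℓ u), ← map_sub]
    refine abs_powMean_le fun v _ => ?_
    rw [Pi.sub_apply, ← hu.length_eq, abs_sub_comm]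
    exact abs_windowSum_append_sub_le hφ u v
  have h4 : Tendsto (fun k : ℕ => 2 * B * ℓ / inflation m ^ k) atTop (𝓝 0) :=
    (tendsto_pow_atTop_atTop_of_one_lt h1).const_div_atTop _
  have h5 : Tendsto (fun k => (powMean p k [x] (fullSum φ ℓ) - inducedMean φ ℓ p k w.1) /
      inflation m ^ k) atTop (𝓝 0) := by
    refine squeeze_zero_norm (fun k => ?_) h4
    rw [Real.norm_eq_abs, abs_div, abs_of_pos (pow_pos h1' k)]
    exact div_le_div_of_nonneg_right (h3 k) (pow_pos h1' k).le
  refine (h5.add h2).congr' ?_ |>.trans (by rw [add_zero])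
  exact Eventually.of_forall fun k => by ring

/-- A second moment estimate. The images of the letters of `W` are independent, so that the variance
of the sum of `φ` over the windows of an image of `W` is at most `|W| C ^ 2`, up to the windows
across the boundaries. The quadratic bound `|y| ≤ y ^ 2 / (2 c) + c / 2` makes this a statement
that is linear in the expectation and can be proved by induction on `W`. -/
lemma powMean_abs_fullSum_sub_le (hφ : ∀ u, |φ u| ≤ B) {k : ℕ} {C c : ℝ}
    (hC : ∀ x u, IsImage (nobleSubst p) k [x] u →
      |fullSum φ ℓ u - powMean p k [x] (fullSum φ ℓ)| ≤ C) (hc : 0 < c) (W : List Letter) (t : ℝ) :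
    powMean p k W (fun u => |fullSum φ ℓ u - t|) ≤ 2 * B * ℓ * W.length +
      ((t - (W.map fun x => powMean p k [x] (fullSum φ ℓ)).sum) ^ 2 + W.length * C ^ 2) / (2 * c)
        + c / 2 := by
  induction W generalizing t with
  | nil =>
    rw [powMean_nil, fullSum_nil]
    have h1 : 0 ≤ (|t| - c) ^ 2 / (2 * c) := by positivity
    have h2 : (|t| - c) ^ 2 / (2 * c) = t ^ 2 / (2 * c) + c / 2 - |t| := by
      rw [sub_sq, sq_abs]; field_simp; ring
    simp only [zero_sub, abs_neg, List.length_nil, List.map_nil, List.sum_nil, Nat.cast_zero]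
    simp only [mul_zero, zero_add, sub_zero, zero_mul, add_zero]
    linarith
  | cons x xs ih =>
    set e : Letter → ℝ := fun x => powMean p k [x] (fullSum φ ℓ) with he
    set E := (xs.map e).sum with hE
    rw [powMean_cons]
    -- The bound is affine in `fullSum φ ℓ u`, so that its mean over `u` only involves `e x`.
    have h1 : ∀ u, IsImage (nobleSubst p) k [x] u →
        powMean p k xs (fun v => |fullSum φ ℓ (u ++ v) - t|) ≤
          (2 * B * ℓ * (xs.length + 1) + ((t - E - e x) ^ 2 + (xs.length + 1) * C ^ 2) / (2 * c)
            + c / 2 + (t - E - e x) / c * e x) - (t - E - e x) / c * fullSum φ ℓ u := by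
      intro u hu
      calc powMean p k xs (fun v => |fullSum φ ℓ (u ++ v) - t|)
          ≤ powMean p k xs ((fun v => |fullSum φ ℓ v - (t - fullSum φ ℓ u)|) +
              fun _ => 2 * B * ℓ) := by
            refine powMean_mono fun v _ => ?_
            have h2 := abs_fullSum_append_sub_le (ℓ := ℓ) hφ u v
            have h3 := abs_add_le (fullSum φ ℓ (u ++ v) - (fullSum φ ℓ u + fullSum φ ℓ v))
              (fullSum φ ℓ v - (t - fullSum φ ℓ u))
            have h4 : fullSum φ ℓ (u ++ v) - (fullSum φ ℓ u + fullSum φ ℓ v) +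
              (fullSum φ ℓ v - (t - fullSum φ ℓ u)) = fullSum φ ℓ (u ++ v) - t := by ring
            rw [h4] at h3
            simp only [Pi.add_apply]
            linarith
        _ ≤ 2 * B * ℓ * xs.length + ((t - fullSum φ ℓ u - E) ^ 2 + xs.length * C ^ 2) / (2 * c)
              + c / 2 + 2 * B * ℓ := by
            rw [map_add, powMean_const]
            exact add_le_add_left (ih _) _
        _ ≤ _ := by
            have h5 : (fullSum φ ℓ u - e x) ^ 2 ≤ C ^ 2 := by
              rw [← sq_abs]
              exact pow_le_pow_left₀ (abs_nonneg _) (hC x u hu) 2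
            have h6 : (t - fullSum φ ℓ u - E) ^ 2 ≤
                (t - E - e x) ^ 2 - 2 * (t - E - e x) * (fullSum φ ℓ u - e x) + C ^ 2 := by
              nlinarith
            have h7 : ((t - fullSum φ ℓ u - E) ^ 2 + xs.length * C ^ 2) / (2 * c) ≤
                ((t - E - e x) ^ 2 - 2 * (t - E - e x) * (fullSum φ ℓ u - e x) + C ^ 2 +
                  xs.length * C ^ 2) / (2 * c) := by
              gcongr
            have h8 : ((t - E - e x) ^ 2 - 2 * (t - E - e x) * (fullSum φ ℓ u - e x) + C ^ 2 +
                  xs.length * C ^ 2) / (2 * c) =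
                ((t - E - e x) ^ 2 + (xs.length + 1) * C ^ 2) / (2 * c) +
                  (t - E - e x) / c * e x - (t - E - e x) / c * fullSum φ ℓ u := by
              field_simp; ring
            linarith
    refine (powMean_mono h1).trans (le_of_eq ?_)
    have h2 : ∀ c₁ c₂ : ℝ, powMean p k [x] (fun u => c₁ - c₂ * fullSum φ ℓ u) = c₁ - c₂ * e x := by
      intro c₁ c₂
      have : (fun u => c₁ - c₂ * fullSum φ ℓ u) = (fun _ => c₁) - c₂ • fullSum φ ℓ := rfl
      rw [this, map_sub, map_smul, powMean_const, smul_eq_mul]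
    rw [h2, List.map_cons, List.sum_cons, List.length_cons, ← hE]
    push_cast
    ring

/-- If `φ` has mean zero for the Perron-Frobenius eigenvector, then the sum of `φ` over the windows
of an image of a letter is, in the mean, small compared to the length of the image. To
see this, the image is cut into many independent images under a smaller power. -/
lemma exists_powMean_abs_fullSum_le (hm : 1 ≤ m) (hp : ∀ i, 0 < p i) (hℓ : 1 ≤ ℓ)
    {R : LegalWord p ℓ → ℝ} (hR : IsRightPF (inducedMatrix p ℓ) R) (hφ : ∀ u, |φ u| ≤ B)
    (h0 : ∑ w : LegalWord p ℓ, φ w.1 * R w = 0) {ε : ℝ} (hε : 0 < ε) :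
    ∃ K, ∀ x, powMean p K [x] (fun u => |fullSum φ ℓ u|) + 2 * B * ℓ ≤ ε * letterLen m K x := by
  have hB : 0 ≤ B := (abs_nonneg _).trans (hφ [])
  have hl := one_lt_inflation hm
  have hl0 : 0 < inflation m := by linarith
  set lam := inflation m with hlam
  set δ := ε / (5 * lam) with hδ
  have hδ0 : 0 < δ := by positivity
  -- First fix `k` so large that the means and the boundary terms are small against `lam ^ k`.
  have hsmall : ∀ x, ∀ᶠ k in atTop, |powMean p k [x] (fullSum φ ℓ)| ≤ δ * lam ^ k := fun x => by
    have h1 := (tendsto_powMean_fullSum hm hp hℓ hR hφ h0 x).norm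
    rw [norm_zero] at h1
    filter_upwards [h1.eventually_le_const hδ0] with k hk
    rwa [Real.norm_eq_abs, abs_div, abs_of_pos (pow_pos hl0 k), div_le_iff₀ (pow_pos hl0 k)] at hk
  have hbd : ∀ᶠ k : ℕ in atTop, 2 * B * ℓ ≤ δ * lam ^ k :=
    ((tendsto_pow_atTop_atTop_of_one_lt hl).const_mul_atTop hδ0).eventually_ge_atTop _
  obtain ⟨k, ⟨hka, hkb⟩, hk⟩ := ((hsmall Letter.a).and (hsmall Letter.b)).and hbd |>.exists
  have hk' : ∀ x, |powMean p k [x] (fullSum φ ℓ)| ≤ δ * lam ^ k := by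
    intro x; cases x <;> assumption
  have hP : 0 < lam ^ k := by positivity
  set C := 2 * (lam ^ k * lam * B) with hC
  have habs : ∀ x u, IsImage (nobleSubst p) k [x] u → |fullSum φ ℓ u| ≤ lam ^ k * lam * B := by
    intro x u hu
    refine (abs_windowSum_le hφ _ _ _).trans (mul_le_mul_of_nonneg_right ?_ hB)
    rw [hu.length_eq, wordLen_singleton]
    refine (letterLen_le hm k x).trans (mul_le_mul_of_nonneg_left ?_ hP.le)
    cases x with
    | a => exact le_rfl
    | b => exact hl.le
  have hCb : ∀ x u, IsImage (nobleSubst p) k [x] u →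
      |fullSum φ ℓ u - powMean p k [x] (fullSum φ ℓ)| ≤ C := by
    intro x u hu
    refine (abs_sub _ _).trans ?_
    have h1 := habs x u hu
    have h2 : |powMean p k [x] (fullSum φ ℓ)| ≤ lam ^ k * lam * B := abs_powMean_le (habs x)
    linarith
  -- Then take `j` so large that the fluctuations of the `letterLen m j x` independent images, each
  -- bounded by `C`, are negligible.
  have hbig : ∀ x, ∀ᶠ j in atTop, C ^ 2 / (2 * (δ * lam ^ k)) ≤
      δ * lam ^ k * (letterLen m j x : ℝ) := fun x =>
    ((tendsto_natCast_atTop_atTop.comp (tendsto_letterLen hm x)).const_mul_atTop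
      (by positivity)).eventually_ge_atTop _
  obtain ⟨j, hja, hjb⟩ := ((hbig Letter.a).and (hbig Letter.b)).exists
  have hj : ∀ x, C ^ 2 / (2 * (δ * lam ^ k)) ≤ δ * lam ^ k * (letterLen m j x : ℝ) := by
    intro x; cases x <;> assumption
  refine ⟨j + k, fun x => ?_⟩
  set n : ℝ := (letterLen m j x : ℝ) with hn
  have hn1 : 1 ≤ n := by rw [hn]; exact_mod_cast letterLen_pos m j x
  have hW : ∀ W, IsImage (nobleSubst p) j [x] W →
      powMean p k W (fun u => |fullSum φ ℓ u|) ≤ 7 / 2 * (δ * lam ^ k * n) := by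
    intro W hWi
    have hWn : (W.length : ℝ) = n := by rw [hWi.length_eq, wordLen_singleton]
    set t := (W.map fun x => powMean p k [x] (fullSum φ ℓ)).sum with ht
    have htb : |t| ≤ n * (δ * lam ^ k) := by
      rw [← hWn, ht]
      clear_value t
      clear hWi hWn ht
      induction W with
      | nil => simp
      | cons y ys ih =>
        rw [List.map_cons, List.sum_cons, List.length_cons]
        push_cast
        have := hk' y
        exact (abs_add_le _ _).trans (by linarith)
    have h1 := powMean_abs_fullSum_sub_le hφ hCb (c := δ * lam ^ k * n) (by positivity) W t
    rw [hWn, ← ht, sub_self] at h1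
    have h2 : powMean p k W (fun u => |fullSum φ ℓ u|) ≤
        powMean p k W (fun u => |fullSum φ ℓ u - t|) + |t| := by
      rw [← powMean_const p k W |t|, ← map_add]
      refine powMean_mono fun u _ => ?_
      have := abs_add_le (fullSum φ ℓ u - t) t
      rwa [sub_add_cancel] at this
    have h3 : (0 ^ 2 + n * C ^ 2) / (2 * (δ * lam ^ k * n)) = C ^ 2 / (2 * (δ * lam ^ k)) := by
      field_simp; ring
    rw [h3] at h1
    have h4 := hj x
    have h5 : 2 * B * ℓ * n ≤ δ * lam ^ k * n := mul_le_mul_of_nonneg_right hk (by linarith)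
    linarith
  have h1 : powMean p (j + k) [x] (fun u => |fullSum φ ℓ u|) ≤ 7 / 2 * (δ * lam ^ k * n) := by
    rw [powMean_add, ← powMean_const p j [x] (7 / 2 * (δ * lam ^ k * n))]
    exact powMean_mono hW
  have h2 : 2 * B * ℓ ≤ δ * lam ^ k * n := hk.trans (le_mul_of_one_le_right (by positivity) hn1)
  have h3 : lam ^ k * n ≤ lam * letterLen m (j + k) x := by
    obtain ⟨W, hWi⟩ := exists_isImage p j [x]
    have h4 : (W.length : ℝ) = n := by rw [hWi.length_eq, wordLen_singleton]
    have h5 := hWi.wordLen_eq (j := k)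
    rw [wordLen_singleton] at h5
    rw [← h4, ← h5]
    clear h4 h5 hWi
    induction W with
    | nil => simp [wordLen_nil]
    | cons y ys ih =>
      rw [wordLen_cons, List.length_cons]
      push_cast
      have := inflation_pow_le_letterLen hm k y
      linarith
  have h6 : δ * (lam ^ k * n) ≤ ε / 5 * letterLen m (j + k) x := by
    calc δ * (lam ^ k * n) ≤ δ * (lam * letterLen m (j + k) x) :=
          mul_le_mul_of_nonneg_left h3 hδ0.le
      _ = ε / 5 * letterLen m (j + k) x := by rw [hδ]; field_simp
  have h7 : 0 ≤ ε * letterLen m (j + k) x := by positivity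
  linarith

/-- The eigenvectors for different lengths are consistent: the marginal of the one for words of
length `L` on any window of length `ℓ` is the one for words of length `ℓ`. Both describe the
frequencies in long images of `a`, and moving the windows by `k` changes a sum over all windows
by a bounded amount only. -/
lemma sum_marginal_eq (hm : 1 ≤ m) (hp : ∀ i, 0 < p i) (hℓ : 1 ≤ ℓ) {L k : ℕ} (hL : k + ℓ ≤ L)
    {R : LegalWord p ℓ → ℝ} (hR : IsRightPF (inducedMatrix p ℓ) R)
    {R' : LegalWord p L → ℝ} (hR' : IsRightPF (inducedMatrix p L) R')
    {g : List Letter → ℝ} (hg : ∀ u, |g u| ≤ B) :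
    ∑ w : LegalWord p L, g ((w.1.drop k).take ℓ) * R' w = ∑ w : LegalWord p ℓ, g w.1 * R w := by
  have hl := one_lt_inflation hm
  have hl0 : 0 < inflation m := by linarith
  set c := ∑ w : LegalWord p ℓ, g w.1 * R w with hc
  set c' := ∑ w : LegalWord p L, g ((w.1.drop k).take ℓ) * R' w with hc'
  have h1 := tendsto_powMean_fullSum (φ := fun u => g u - c) (B := B + |c|) hm hp hℓ hR
    (fun u => (abs_sub _ _).trans (add_le_add_left (hg u) _))
    (by simp only [sub_mul, Finset.sum_sub_distrib, ← Finset.mul_sum, hR.2.2]; simp [hc]) Letter.a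
  have h2 := tendsto_powMean_fullSum (φ := fun u => g ((u.drop k).take ℓ) - c') (B := B + |c'|)
    hm hp (hℓ.trans (by omega)) hR' (fun u => (abs_sub _ _).trans (add_le_add_left (hg _) _))
    (by simp only [sub_mul, Finset.sum_sub_distrib, ← Finset.mul_sum, hR'.2.2]; simp [hc']) Letter.a
  have h3 : ∀ v, |fullSum (fun u => g ((u.drop k).take ℓ) - c') L v -
      fullSum (fun u => g u - c) ℓ v - (c - c') * v.length| ≤ 2 * (k * B) := by
    intro v
    have h4 := abs_sum_range_shift_sub_le (Φ := fun i => g ((v.drop i).take ℓ)) (fun i => hg _) k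
      v.length
    refine le_of_eq_of_le (congrArg abs ?_) h4
    simp only [fullSum, windowSum, Finset.sum_sub_distrib, Finset.sum_const, Finset.card_range,
      nsmul_eq_mul]
    have h5 : ∀ i, (((v.drop i).take L).drop k).take ℓ = (v.drop (k + i)).take ℓ := fun i => by
      rw [List.drop_take, List.take_take, List.drop_drop, min_eq_left (by omega), add_comm]
    simp only [h5]
    ring
  have h6 : ∀ j, |powMean p j [Letter.a] (fullSum (fun u => g ((u.drop k).take ℓ) - c') L) -
      powMean p j [Letter.a] (fullSum (fun u => g u - c) ℓ) -
      (c - c') * letterLen m j Letter.a| ≤ 2 * (k * B) := by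
    intro j
    rw [← powMean_const p j [Letter.a] ((c - c') * letterLen m j Letter.a), ← map_sub, ← map_sub]
    refine abs_powMean_le fun v hv => ?_
    have := h3 v
    rwa [hv.length_eq, wordLen_singleton] at this
  have h7 : Tendsto (fun j : ℕ => 2 * (k * B) / inflation m ^ j) atTop (𝓝 0) :=
    (tendsto_pow_atTop_atTop_of_one_lt hl).const_div_atTop _
  have h8 : |c - c'| / inflation m ≤ 0 := by
    have h9 := ((h1.norm.add h2.norm).add h7)
    simp only [norm_zero, add_zero] at h9
    refine ge_of_tendsto' h9 fun j => ?_
    have hP : 0 < inflation m ^ j := pow_pos hl0 j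
    rw [Real.norm_eq_abs, Real.norm_eq_abs, abs_div, abs_div, abs_of_pos hP, ← add_div, ← add_div,
      div_le_div_iff₀ hl0 hP]
    have h10 := h6 j
    have h11 : |c - c'| * letterLen m j Letter.a ≤
        |powMean p j [Letter.a] (fullSum (fun u => g u - c) ℓ)| +
        |powMean p j [Letter.a] (fullSum (fun u => g ((u.drop k).take ℓ) - c') L)| +
          2 * (k * B) := by
      rw [← abs_of_nonneg (Nat.cast_nonneg (α := ℝ) (letterLen m j Letter.a)), ← abs_mul]
      set X := powMean p j [Letter.a] (fullSum (fun u => g u - c) ℓ)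
      set Y := powMean p j [Letter.a] (fullSum (fun u => g ((u.drop k).take ℓ) - c') L)
      set Z := (c - c') * (letterLen m j Letter.a : ℝ)
      have hX := neg_abs_le X
      have hX' := le_abs_self X
      have hY := neg_abs_le Y
      have hY' := le_abs_self Y
      rw [abs_le] at h10 ⊢
      constructor <;> linarith [h10.1, h10.2]
    have h12 := inflation_pow_le_letterLen hm j Letter.a
    calc |c - c'| * inflation m ^ j
        ≤ |c - c'| * (inflation m * letterLen m j Letter.a) :=
          mul_le_mul_of_nonneg_left h12 (abs_nonneg _)
      _ = (|c - c'| * letterLen m j Letter.a) * inflation m := by ring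
      _ ≤ _ := mul_le_mul_of_nonneg_right h11 hl0.le
  rw [div_le_iff₀ hl0, zero_mul] at h8
  have := abs_eq_zero.1 (le_antisymm h8 (abs_nonneg _))
  linarith

lemma exists_wordLen_take_le {A K : ℕ} (hA : ∀ x, letterLen m K x ≤ A) (w : List Letter) (n : ℕ)
    (h : n ≤ wordLen m K w) :
    ∃ r, wordLen m K (w.take r) ≤ n ∧ n ≤ wordLen m K (w.take r) + A := by
  induction w generalizing n with
  | nil => exact ⟨0, by simp [wordLen_nil], h.trans (by simp [wordLen_nil])⟩
  | cons x xs ih =>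
    rw [wordLen_cons] at h
    by_cases hx : n ≤ letterLen m K x
    · exact ⟨0, by simp [wordLen_nil], by simpa [wordLen_nil] using hx.trans (hA x)⟩
    · obtain ⟨r, hr1, hr2⟩ := ih (n - letterLen m K x) (by omega)
      refine ⟨r + 1, ?_, ?_⟩ <;> rw [List.take_succ_cons, wordLen_cons] <;> omega

/-- The mean ergodic estimate on words: long legal words, distributed according to the
Perron-Frobenius eigenvector, have averages of `φ` that are small in the mean. Such a word is a
window in an image of a legal word under a power of the substitution, and up to its ends it consists
of images of letters. -/
lemma exists_sum_abs_windowSum_le (hm : 1 ≤ m) (hp : ∀ i, 0 < p i) (hℓ : 1 ≤ ℓ)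
    {R : LegalWord p ℓ → ℝ} (hR : IsRightPF (inducedMatrix p ℓ) R) (hφ : ∀ u, |φ u| ≤ B)
    (h0 : ∑ w : LegalWord p ℓ, φ w.1 * R w = 0) {ε : ℝ} (hε : 0 < ε) :
    ∃ n : ℕ, 1 ≤ n ∧ ∀ R' : LegalWord p (n + ℓ) → ℝ, IsRightPF (inducedMatrix p (n + ℓ)) R' →
      ∑ w : LegalWord p (n + ℓ), |windowSum φ ℓ n w.1| * R' w ≤ ε * n := by
  have hB : 0 ≤ B := (abs_nonneg _).trans (hφ [])
  have hl := one_lt_inflation hm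
  have hl0 : 0 < inflation m := by linarith
  obtain ⟨K, hK⟩ := exists_powMean_abs_fullSum_le hm hp hℓ hR hφ h0 (half_pos hε)
  set A := letterLen m K Letter.a + letterLen m K Letter.b with hA
  have hA' : ∀ x, letterLen m K x ≤ A := by intro x; cases x <;> omega
  set D := 2 * B * ℓ + 3 * (A * B) with hD
  -- `D` bounds the contribution of the two ends of a window; it does not depend on `n`.
  obtain ⟨n, hn⟩ := exists_nat_ge (D / (ε / 2) + 1)
  have hD0 : 0 ≤ D := by positivity
  have hn1 : (1 : ℝ) ≤ n := le_trans (le_add_of_nonneg_left (by positivity)) hn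
  have hDn : D ≤ ε / 2 * n := by
    have : D / (ε / 2) ≤ n := by linarith
    rwa [div_le_iff₀' (by positivity)] at this
  refine ⟨n, by exact_mod_cast hn1, fun R' hR' => ?_⟩
  have hL : 1 ≤ n + ℓ := by omega
  -- The bound for a concatenation of images of letters.
  have hW : ∀ W : List Letter, powMean p K W (fun u => |fullSum φ ℓ u|) ≤
      ε / 2 * wordLen m K W := by
    intro W
    induction W with
    | nil => rw [powMean_nil, fullSum_nil, wordLen_nil]; simp
    | cons x xs ih =>
      have h1 : powMean p K (x :: xs) (fun u => |fullSum φ ℓ u|) ≤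
          powMean p K [x] ((fun u => |fullSum φ ℓ u|) + fun _ =>
            (2 * B * ℓ + powMean p K xs fun v => |fullSum φ ℓ v|)) := by
        rw [powMean_cons]
        refine powMean_mono fun u _ => ?_
        have h2 : powMean p K xs (fun v => |fullSum φ ℓ (u ++ v)|) ≤
            powMean p K xs ((fun _ => |fullSum φ ℓ u| + 2 * B * ℓ) + fun v => |fullSum φ ℓ v|) := by
          refine powMean_mono fun v _ => ?_
          have h3 := abs_fullSum_append_sub_le (ℓ := ℓ) hφ u v
          have h4 := abs_add_le (fullSum φ ℓ (u ++ v) - (fullSum φ ℓ u + fullSum φ ℓ v))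
            (fullSum φ ℓ u + fullSum φ ℓ v)
          rw [sub_add_cancel] at h4
          have h5 := abs_add_le (fullSum φ ℓ u) (fullSum φ ℓ v)
          rw [Pi.add_apply]
          linarith
        rw [map_add, powMean_const] at h2
        rw [Pi.add_apply]
        linarith
      rw [map_add, powMean_const] at h1
      rw [wordLen_cons]
      push_cast
      have := hK x
      linarith
  set g : List Letter → ℝ := fun w => |windowSum φ ℓ n w| with hg
  have hpt : ∀ w : LegalWord p (n + ℓ), inducedMean g (n + ℓ) p K w.1 ≤
      inducedMean (fun _ => ε * n) (n + ℓ) p K w.1 := by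
    rintro ⟨w, hw, hwl⟩
    have hnw : n ≤ wordLen m K w := by
      have := length_le_wordLen m K w
      omega
    obtain ⟨r, hr1, hr2⟩ := exists_wordLen_take_le hA' w n hnw
    set N₁ := wordLen m K (w.take 1) with hN₁
    have hN₁A : N₁ ≤ A := by
      cases w with
      | nil => rw [hN₁]; simp [wordLen_nil]
      | cons x xs => rw [hN₁, List.take_succ_cons, List.take_zero, wordLen_singleton]; exact hA' x
    have hconst : inducedMean (fun _ => ε * n) (n + ℓ) p K w = N₁ * (ε * n) := by
      have : windowSum (fun _ => ε * n) (n + ℓ) (wordLen m K (w.take 1)) =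
          fun _ => N₁ * (ε * n) := by
        ext v; simp [windowSum, hN₁]
      rw [inducedMean, this, powMean_const]
    -- All windows of length `n` that start in the image of the first letter nearly agree with the
    -- image `v₁` of the first `r` letters of `w`, where `r` is such that `|v₁|` is close to `n`.
    have hreal : ∀ v₁ v₂, IsImage (nobleSubst p) K (w.take r) v₁ →
        windowSum g (n + ℓ) N₁ (v₁ ++ v₂) ≤ N₁ * (|fullSum φ ℓ v₁| + D) := by
      intro v₁ v₂ h₁
      have hlen := h₁.length_eq
      have hterm : ∀ j ∈ Finset.range N₁, g (((v₁ ++ v₂).drop j).take (n + ℓ)) ≤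
          |fullSum φ ℓ v₁| + D := by
        intro j hj
        rw [Finset.mem_range] at hj
        set Φ : ℕ → ℝ := fun i => φ (((v₁ ++ v₂).drop i).take ℓ) with hΦ
        have e1 : windowSum φ ℓ n (((v₁ ++ v₂).drop j).take (n + ℓ)) =
            ∑ i ∈ Finset.range n, Φ (j + i) := by
          refine Finset.sum_congr rfl fun i hi => ?_
          rw [Finset.mem_range] at hi
          rw [List.drop_take, List.take_take, List.drop_drop, min_eq_left (by omega)]
        have e2 : ∑ i ∈ Finset.range n, Φ i = windowSum φ ℓ n (v₁ ++ v₂) := rfl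
        have e3 := abs_sum_range_shift_sub_le (Φ := Φ) (fun i => hφ _) j n
        obtain ⟨d, hd⟩ := Nat.exists_eq_add_of_le hr1
        have e4 := abs_windowSum_add_sub_le hφ ℓ (wordLen m K (w.take r)) d (v₁ ++ v₂)
        rw [← hd] at e4
        have e5 := abs_windowSum_append_sub_le (ℓ := ℓ) hφ v₁ v₂
        rw [hlen] at e5
        have hdA : (d : ℝ) * B ≤ A * B :=
          mul_le_mul_of_nonneg_right (by exact_mod_cast (by omega : d ≤ A)) hB
        have hjA : (j : ℝ) * B ≤ A * B :=
          mul_le_mul_of_nonneg_right (by exact_mod_cast (by omega : j ≤ A)) hB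
        rw [e2] at e3
        simp only [hg, e1]
        have hF := neg_abs_le (fullSum φ ℓ v₁)
        have hF' := le_abs_self (fullSum φ ℓ v₁)
        rw [abs_le] at e3 e4 e5 ⊢
        constructor <;> linarith [e3.1, e3.2, e4.1, e4.2, e5.1, e5.2]
      have := Finset.sum_le_card_nsmul _ _ _ hterm
      rwa [Finset.card_range, nsmul_eq_mul] at this
    have h1 : inducedMean g (n + ℓ) p K w ≤ N₁ * (ε / 2 * n + D) := by
      rw [inducedMean, ← hN₁]
      conv_lhs => rw [← List.take_append_drop r w, powMean_append]
      calc _ ≤ powMean p K (w.take r)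
            ((N₁ : ℝ) • ((fun v₁ => |fullSum φ ℓ v₁|) + fun _ => D)) := by
            refine powMean_mono fun v₁ h₁ => ?_
            rw [Pi.smul_apply, Pi.add_apply, smul_eq_mul,
              ← powMean_const p K (w.drop r) (N₁ * (|fullSum φ ℓ v₁| + D))]
            exact powMean_mono fun v₂ _ => hreal v₁ v₂ h₁
        _ = N₁ * (powMean p K (w.take r) (fun v₁ => |fullSum φ ℓ v₁|) + D) := by
            rw [map_smul, map_add, powMean_const, smul_eq_mul]
        _ ≤ _ := by
            refine mul_le_mul_of_nonneg_left (add_le_add_left ((hW _).trans ?_) _)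
              (Nat.cast_nonneg _)
            exact mul_le_mul_of_nonneg_left (by exact_mod_cast hr1) (by positivity)
    rw [hconst]
    refine h1.trans (mul_le_mul_of_nonneg_left ?_ (Nat.cast_nonneg _))
    linarith
  -- The eigenvector equation for the `K`-th power of the induced matrix.
  have hpair : ∀ f : List Letter → ℝ,
      ∑ w : LegalWord p (n + ℓ), inducedMean f (n + ℓ) p K w.1 * R' w =
        inflation m ^ K * ∑ w : LegalWord p (n + ℓ), f w.1 * R' w := by
    intro f
    have h1 := dotProduct_mulVec (fun u : LegalWord p (n + ℓ) => f u.1)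
      (inducedMatrix p (n + ℓ) ^ K) R'
    rw [vecMul_inducedMatrix_pow hL, pow_mulVec_eq_of_mulVec_eq (hR'.mulVec_eq hm hp hL),
      dotProduct_smul] at h1
    exact h1.symm
  have h1 : ∑ w : LegalWord p (n + ℓ), inducedMean g (n + ℓ) p K w.1 * R' w ≤
      ∑ w : LegalWord p (n + ℓ), inducedMean (fun _ => ε * n) (n + ℓ) p K w.1 * R' w :=
    Finset.sum_le_sum fun w _ => mul_le_mul_of_nonneg_right (hpt w) (hR'.2.1 w).le
  rw [hpair g, hpair fun _ => ε * n, ← Finset.mul_sum, hR'.2.2, mul_one] at h1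
  exact le_of_mul_le_mul_left h1 (pow_pos hl0 K)

end Frequencies

/-! ### Words in the hull -/

section Hull

open Filter Topology

/-- The word of length `n` that `x` carries from position `k` on. -/
def subword (x : ℤ → Letter) (k : ℤ) (n : ℕ) : List Letter :=
  List.ofFn fun i : Fin n => x (k + (i : ℕ))

@[simp] lemma length_subword (x : ℤ → Letter) (k : ℤ) (n : ℕ) : (subword x k n).length = n := by
  simp [subword]

lemma take_drop_subword (x : ℤ → Letter) (k : ℤ) {j ℓ n : ℕ} (h : j + ℓ ≤ n) :
    ((subword x k n).drop j).take ℓ = subword x (k + j) ℓ := by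
  refine List.ext_getElem (by simp; omega) fun i h1 h2 => ?_
  simp only [subword, List.getElem_take, List.getElem_drop, List.getElem_ofFn]
  congr 1
  push_cast
  ring

lemma isClopen_setOf_subword (k : ℤ) (n : ℕ) (P : List Letter → Prop) :
    IsClopen {x : ℤ → Letter | P (subword x k n)} := by
  have hc : Continuous fun (x : ℤ → Letter) (i : Fin n) => x (k + (i : ℕ)) := by fun_prop
  exact (isClopen_discrete {f : Fin n → Letter | P (List.ofFn f)}).preimage hc

lemma subword_shift (x : ℤ → Letter) (k : ℤ) (n : ℕ) :
    subword (shift x) k n = subword x (k + 1) n := by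
  simp only [subword, shift]
  congr 1
  ext i
  congr 1
  ring

lemma embedPair_apply {u v : List Letter} {n : ℤ} {i : ℕ} (hi : n + u.length = i)
    (h : i < (u ++ v).length) : embedPair u v n = (u ++ v)[i] := by
  rw [List.length_append] at h
  unfold embedPair
  split_ifs with hn
  · obtain ⟨j, rfl⟩ := Int.eq_ofNat_of_zero_le hn
    have hij : i = j + u.length := by omega
    subst hij
    rw [List.getElem_append_right (by omega), Int.toNat_natCast,
      List.getD_eq_getElem _ _ (by omega)]
    congr 1
    omega
  · rw [List.getElem_append_left (by omega), List.getD_eq_getElem _ _ (by simp; omega),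
      List.getElem_reverse]
    congr 1
    omega

lemma subword_embedPair {u v : List Letter} {k : ℤ} {n : ℕ} (h1 : -(u.length : ℤ) ≤ k)
    (h2 : k + n ≤ v.length) :
    subword (embedPair u v) k n = ((u ++ v).drop (k + u.length).toNat).take n := by
  refine List.ext_getElem (by simp; omega) fun i hi hi' => ?_
  rw [length_subword] at hi
  simp only [subword, List.getElem_take, List.getElem_drop, List.getElem_ofFn]
  exact embedPair_apply (by push_cast; omega) _

variable {m : ℕ} {p : PMF (Fin (m + 1))}

lemma mem_cylinder {k : ℤ} {v : List Letter} {x : hull p} :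
    x ∈ cylinder p k v ↔ subword x.1 k v.length = v := by
  conv_rhs => rhs; rw [← List.ofFn_get v]
  rw [subword, List.ofFn_inj, funext_iff]
  rfl

lemma isClosed_hull : IsClosed (hull p) := isClosed_sInter fun _ hY => hY.1

lemma translate_mem {Y : Set (ℤ → Letter)} (hY : shift '' Y = Y) {x : ℤ → Letter} (hx : x ∈ Y)
    (d : ℤ) : (fun n => x (n + d)) ∈ Y := by
  induction d using Int.induction_on with
  | zero => simpa using hx
  | succ d ih =>
    rw [← hY]
    refine ⟨_, ih, ?_⟩
    ext n
    simp only [shift]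
    congr 1
    ring
  | pred d ih =>
    rw [← hY] at ih
    obtain ⟨y, hy, hyx⟩ := ih
    convert hy using 1
    ext n
    have := congrFun hyx (n - 1)
    simp only [shift, sub_add_cancel] at this
    rw [this]
    congr 1
    ring

/-- The sequences that only carry legal words form a closed and shift-invariant set. It contains
the generating words, because `aa` is legal. -/
lemma legal_subword (hm : 1 ≤ m) (hp : ∀ i, 0 < p i) {x : ℤ → Letter} (hx : x ∈ hull p) (k : ℤ)
    (n : ℕ) : Legal p (subword x k n) := by
  suffices h : {x : ℤ → Letter | ∀ (k : ℤ) (n : ℕ), Legal p (subword x k n)} ∈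
      {Y | IsClosed Y ∧ shift '' Y = Y ∧ generatingWords p ⊆ Y} from hx _ h k n
  refine ⟨?_, ?_, ?_⟩
  · simp only [Set.ofPred_forall]
    exact isClosed_iInter fun k => isClosed_iInter fun n => (isClopen_setOf_subword k n _).1
  · refine Set.Subset.antisymm ?_ fun x hx => ⟨fun n => x (n - 1), fun k n => ?_, ?_⟩
    · rintro _ ⟨x, hx, rfl⟩ k n
      rw [subword_shift]
      exact hx _ _
    · have h1 := hx (k - 1) n
      have h2 : x = shift fun n => x (n - 1) := by ext n; simp [shift]
      rw [h2, subword_shift, sub_add_cancel] at h1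
      exact h1
    · ext n; simp [shift]
  · rintro w ⟨y, hy, hw⟩ k n
    have h1 : ∃ᶠ j in atTop, subword (y j) k n = subword w k n :=
      hw.frequently ((isClopen_setOf_subword k n (· = subword w k n)).2.mem_nhds rfl)
    have h2 := (tendsto_letterLen hm Letter.a).eventually_ge_atTop (k.natAbs + n)
    obtain ⟨j, hj1, hj2⟩ := (h1.and_eventually h2).exists
    obtain ⟨u, v, hu, hv, hyj⟩ := hy j
    have hul := hu.length_eq
    have hvl := hv.length_eq
    rw [wordLen_singleton] at hul hvl
    rw [← hj1, hyj, subword_embedPair (by omega) (by omega)]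
    refine ((legal_aa hm hp).of_isImage (isImage_append (w₁ := [Letter.a]).2
      ⟨u, hu, v, hv, rfl⟩)).of_infix ?_
    exact (List.take_prefix _ _).isInfix.trans (List.drop_suffix _ _).isInfix

/-- The sequence is a translate of a limit of images of `a | a` that carry `w` at a fixed
position. -/
lemma Legal.exists_mem_hull (hm : 1 ≤ m) (hp : ∀ i, 0 < p i) {w : List Letter} (hw : Legal p w)
    (k : ℤ) : ∃ x ∈ hull p, subword x k w.length = w := by
  obtain ⟨s, K, hK⟩ := hw.exists_prefix hm hp
  have hex : ∀ j, ∃ v, IsImage (nobleSubst p) j [Letter.a] v ∧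
      (K ≤ j → ∃ t, v = s ++ w ++ t) := fun j => by
    by_cases hj : K ≤ j
    · obtain ⟨t, ht⟩ := hK j hj
      exact ⟨_, ht, fun _ => ⟨t, rfl⟩⟩
    · obtain ⟨v, hv⟩ := exists_isImage p j [Letter.a]
      exact ⟨v, hv, fun h => absurd h hj⟩
  choose v hv hvK using hex
  obtain ⟨z, hz⟩ : ∃ z, MapClusterPt z atTop fun j => embedPair (v j) (v j) :=
    exists_clusterPt_of_compactSpace _
  have hzh : z ∈ hull p := fun Y hY =>
    hY.2.2 ⟨fun j => embedPair (v j) (v j), fun j => ⟨v j, v j, hv j, hv j, rfl⟩, hz⟩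
  have hsub : subword z s.length w.length = w := by
    have hcl := isClopen_setOf_subword s.length w.length (· ≠ w)
    by_contra hne
    have h1 := hz.frequently (hcl.2.mem_nhds hne)
    refine h1 ?_
    filter_upwards [eventually_ge_atTop K] with j hj
    obtain ⟨t, ht⟩ := hvK j hj
    simp only [not_not]
    rw [subword_embedPair (by omega) (by rw [ht]; simp), ht,
      show ((s.length : ℤ) + ((s ++ w ++ t).length : ℕ)).toNat = (s ++ w ++ t).length + s.length by
        omega, ← List.drop_drop, List.drop_left, List.append_assoc, List.drop_left,
      List.take_left]
  refine ⟨fun n => z (n + (s.length - k)), fun Y hY => translate_mem hY.2.1 (hzh Y hY) _, ?_⟩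
  refine Eq.trans ?_ hsub
  simp only [subword]
  congr 1
  ext i
  congr 1
  ring

end Hull

/-! ### The measure on the hull -/

section Measure

open MeasureTheory Filter Topology

instance : BorelSpace Letter := ⟨by rw [borel_eq_top_of_discrete]; rfl⟩

variable {m : ℕ} {p : PMF (Fin (m + 1))}

instance : CompactSpace (hull p) := isCompact_iff_compactSpace.1 isClosed_hull.isCompact

lemma isClopen_cylinder (k : ℤ) (v : List Letter) : IsClopen (cylinder p k v) := by
  have h : cylinder p k v = Subtype.val ⁻¹' {x : ℤ → Letter | subword x k v.length = v} := by
    ext x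
    exact mem_cylinder
  rw [h]
  exact (isClopen_setOf_subword k v.length (· = v)).preimage continuous_subtype_val

lemma measurableSet_cylinder (k : ℤ) (v : List Letter) : MeasurableSet (cylinder p k v) :=
  (isClopen_cylinder k v).1.measurableSet

lemma cylinder_eq_empty (hm : 1 ≤ m) (hp : ∀ i, 0 < p i) {v : List Letter} (hv : ¬ Legal p v)
    (k : ℤ) : cylinder p k v = ∅ := by
  refine Set.eq_empty_of_forall_notMem fun x hx => hv ?_
  rw [← mem_cylinder.1 hx]
  exact legal_subword hm hp x.2 _ _

/-- A cylinder set of a longer word lies in a cylinder set of a subword, or is disjoint from it. -/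
lemma mem_cylinder_iff_of_mem {k : ℤ} {j L : ℕ} {W v : List Letter} (hW : W.length = L)
    (hj : j + v.length ≤ L) {x : hull p} (hx : x ∈ cylinder p k W) :
    x ∈ cylinder p (k + j) v ↔ (W.drop j).take v.length = v := by
  rw [mem_cylinder] at hx
  rw [mem_cylinder, ← take_drop_subword x.1 k (hj.trans hW.ge), hx]

/-- The cylinder sets of the legal words of a given length at a given position partition the
hull. -/
lemma measureReal_eq_sum_cylinder (hm : 1 ≤ m) (hp : ∀ i, 0 < p i) (μ : Measure (hull p))
    [IsFiniteMeasure μ] {A : Set (hull p)} (hA : MeasurableSet A) (k : ℤ) (L : ℕ) :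
    μ.real A = ∑ W : LegalWord p L, μ.real (A ∩ cylinder p k W.1) := by
  rw [← measureReal_iUnion_fintype]
  · congr 1
    refine Set.Subset.antisymm (fun x hx => ?_) (Set.iUnion_subset fun W => Set.inter_subset_left)
    refine Set.mem_iUnion.2 ⟨⟨subword x.1 k L, legal_subword hm hp x.2 _ _, by simp⟩, hx, ?_⟩
    rw [mem_cylinder]
    simp
  · intro W W' hWW'
    refine Set.disjoint_left.2 fun x hx hx' => hWW' (Subtype.ext ?_)
    rw [← mem_cylinder.1 hx.2, ← mem_cylinder.1 hx'.2, W.2.2, W'.2.2]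
  · exact fun W => hA.inter (measurableSet_cylinder _ _)

lemma measureReal_inter_cylinder_eq_sum (hm : 1 ≤ m) (hp : ∀ i, 0 < p i) (μ : Measure (hull p))
    [IsFiniteMeasure μ] {A : Set (hull p)} (hA : MeasurableSet A) (k : ℤ) {j L : ℕ}
    {v : List Letter} (hj : j + v.length ≤ L) :
    μ.real (A ∩ cylinder p (k + j) v) = ∑ W : LegalWord p L,
      wordIndicator v ((W.1.drop j).take v.length) * μ.real (A ∩ cylinder p k W.1) := by
  rw [measureReal_eq_sum_cylinder hm hp μ (hA.inter (measurableSet_cylinder _ _)) k L]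
  refine Finset.sum_congr rfl fun W _ => ?_
  by_cases h : (W.1.drop j).take v.length = v
  · rw [wordIndicator, if_pos h, one_mul]
    congr 1
    ext x
    exact ⟨fun hx => ⟨hx.1.1, hx.2⟩, fun hx =>
      ⟨⟨hx.1, (mem_cylinder_iff_of_mem W.2.2 hj hx.2).2 h⟩, hx.2⟩⟩
  · rw [wordIndicator, if_neg h, zero_mul]
    have : A ∩ cylinder p (k + j) v ∩ cylinder p k W.1 = ∅ :=
      Set.eq_empty_of_forall_notMem fun x hx => h ((mem_cylinder_iff_of_mem W.2.2 hj hx.2).1 hx.1.2)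
    rw [this, measureReal_empty]

variable (p) in
/-- The cylinder sets of the words on the intervals `[-n, n]`. Any two of them are disjoint or
nested. -/
def centralCylinders : Set (Set (hull p)) :=
  {s | ∃ (n : ℕ) (v : List Letter), v.length = 2 * n + 1 ∧ s = cylinder p (-(n : ℤ)) v}

lemma cylinder_subset_of_mem {n n' : ℕ} (hn : n ≤ n') {v v' : List Letter}
    (hv : v.length = 2 * n + 1) (hv' : v'.length = 2 * n' + 1) {x : hull p}
    (hx : x ∈ cylinder p (-(n : ℤ)) v) (hx' : x ∈ cylinder p (-(n' : ℤ)) v') :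
    cylinder p (-(n' : ℤ)) v' ⊆ cylinder p (-(n : ℤ)) v := by
  have h : (-(n : ℤ)) = -(n' : ℤ) + (n' - n : ℕ) := by omega
  have hle : n' - n + v.length ≤ 2 * n' + 1 := by omega
  intro y hy
  rw [h] at hx ⊢
  rw [mem_cylinder_iff_of_mem hv' hle hy]
  exact (mem_cylinder_iff_of_mem hv' hle hx').1 hx

lemma isPiSystem_centralCylinders : IsPiSystem (centralCylinders p) := by
  rintro _ ⟨n, v, hv, rfl⟩ _ ⟨n', v', hv', rfl⟩ ⟨x, hx, hx'⟩
  rcases le_total n n' with h | h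
  · rw [Set.inter_eq_right.2 (cylinder_subset_of_mem h hv hv' hx hx')]
    exact ⟨n', v', hv', rfl⟩
  · rw [Set.inter_eq_left.2 (cylinder_subset_of_mem h hv' hv hx' hx)]
    exact ⟨n, v, hv, rfl⟩

lemma generateFrom_centralCylinders :
    (inferInstance : MeasurableSpace (hull p)) =
      MeasurableSpace.generateFrom (centralCylinders p) := by
  refine le_antisymm ?_ (MeasurableSpace.generateFrom_le ?_)
  · rw [show (inferInstance : MeasurableSpace (hull p)) =
      MeasurableSpace.comap Subtype.val MeasurableSpace.pi from rfl,
      MeasurableSpace.comap_le_iff_le_map]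
    refine iSup_le fun i => MeasurableSpace.comap_le_iff_le_map.2 fun S _ => ?_
    set n := i.natAbs with hn
    change MeasurableSet[MeasurableSpace.generateFrom (centralCylinders p)]
      {x : hull p | x.1 i ∈ S}
    have hS : {x : hull p | x.1 i ∈ S} = ⋃ v ∈ {v : List Letter | v.length = 2 * n + 1 ∧
        v.getD (i + n).toNat Letter.a ∈ S}, cylinder p (-(n : ℤ)) v := by
      have hval : ∀ x : hull p,
          (subword x.1 (-(n : ℤ)) (2 * n + 1)).getD (i + n).toNat Letter.a = x.1 i := fun x => by
        rw [List.getD_eq_getElem _ _ (by simp; omega)]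
        simp only [subword, List.getElem_ofFn]
        have hidx : -(n : ℤ) + ((i + n).toNat : ℤ) = i := by omega
        exact congrArg x.1 hidx
      ext x
      simp only [Set.mem_iUnion]
      constructor
      · intro hx
        refine ⟨subword x.1 (-(n : ℤ)) (2 * n + 1), ⟨by simp, ?_⟩, ?_⟩
        · rw [hval]; exact hx
        · rw [mem_cylinder]; simp
      · rintro ⟨v, ⟨hv, hvS⟩, hx⟩
        rw [mem_cylinder, hv] at hx
        rw [← hx, hval] at hvS
        exact hvS
    rw [hS]
    refine MeasurableSet.biUnion (Set.to_countable _) fun v hv => ?_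
    exact MeasurableSpace.measurableSet_generateFrom ⟨n, v, hv.1, rfl⟩
  · rintro _ ⟨n, v, hv, rfl⟩
    exact measurableSet_cylinder _ _

lemma IsNobleMeasure.isProbabilityMeasure (hm : 1 ≤ m) (hp : ∀ i, 0 < p i)
    {μ : Measure (hull p)} (hμ : IsNobleMeasure p μ) : IsProbabilityMeasure μ := by
  obtain ⟨R, hR, hμR⟩ := hμ 1 le_rfl
  have hU : (Set.univ : Set (hull p)) = ⋃ W : LegalWord p 1, cylinder p 0 W.1 := by
    refine (Set.eq_univ_of_forall fun x => ?_).symm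
    refine Set.mem_iUnion.2 ⟨⟨subword x.1 0 1, legal_subword hm hp x.2 _ _, by simp⟩, ?_⟩
    rw [mem_cylinder]
    simp
  constructor
  rw [hU, measure_iUnion]
  · simp only [hμR 0]
    rw [tsum_fintype, ← ENNReal.ofReal_sum_of_nonneg fun i _ => (hR.2.1 i).le, hR.2.2,
      ENNReal.ofReal_one]
  · intro W W' hWW'
    refine Set.disjoint_left.2 fun x hx hx' => hWW' (Subtype.ext ?_)
    rw [← mem_cylinder.1 hx, ← mem_cylinder.1 hx', W.2.2, W'.2.2]
  · exact fun W => measurableSet_cylinder _ _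

lemma IsNobleMeasure.measure_cylinder_eq (hm : 1 ≤ m) (hp : ∀ i, 0 < p i)
    {μ ν : Measure (hull p)} (hμ : IsNobleMeasure p μ) (hν : IsNobleMeasure p ν) (k k' : ℤ)
    {v : List Letter} (hv : 1 ≤ v.length) : μ (cylinder p k v) = ν (cylinder p k' v) := by
  by_cases hleg : Legal p v
  · obtain ⟨R, hR, hμR⟩ := hμ v.length hv
    obtain ⟨R', hR', hνR⟩ := hν v.length hv
    rw [(existsUnique_isRightPF_inducedMatrix hm hp hv).unique hR hR'] at hμR
    exact (hμR k ⟨v, hleg, rfl⟩).trans (hνR k' ⟨v, hleg, rfl⟩).symm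
  · rw [cylinder_eq_empty hm hp hleg, cylinder_eq_empty hm hp hleg, measure_empty, measure_empty]

lemma IsNobleMeasure.eq (hm : 1 ≤ m) (hp : ∀ i, 0 < p i) {μ ν : Measure (hull p)}
    (hμ : IsNobleMeasure p μ) (hν : IsNobleMeasure p ν) : μ = ν := by
  have h1 := hμ.isProbabilityMeasure hm hp
  have h2 := hν.isProbabilityMeasure hm hp
  refine ext_of_generate_finite _ generateFrom_centralCylinders isPiSystem_centralCylinders ?_
    (by rw [measure_univ, measure_univ])
  rintro _ ⟨n, v, hv, rfl⟩
  exact hμ.measure_cylinder_eq hm hp hν _ _ (by omega)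

/-- Existence of the measure: a limit point of the measures that give the mass `R w` to one point
of the cylinder set of `w` at `-n`, for all legal words `w` of length `2 n + 1`. For a fixed
cylinder set the masses are eventually constant, by the consistency of the eigenvectors. -/
lemma exists_isNobleMeasure (hm : 1 ≤ m) (hp : ∀ i, 0 < p i) :
    ∃ μ : Measure (hull p), IsNobleMeasure p μ := by
  choose R hR using fun ℓ : {ℓ : ℕ // 1 ≤ ℓ} =>
    (existsUnique_isRightPF_inducedMatrix (p := p) hm hp ℓ.2).exists
  let L : ℕ → {ℓ : ℕ // 1 ≤ ℓ} := fun n => ⟨2 * n + 1, by omega⟩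
  choose pt hpt hptw using fun (n : ℕ) (w : LegalWord p (L n)) =>
    w.2.1.exists_mem_hull hm hp (-(n : ℤ))
  let ν : ℕ → Measure (hull p) := fun n =>
    ∑ w : LegalWord p (L n), ENNReal.ofReal (R (L n) w) • Measure.dirac ⟨pt n w, hpt n w⟩
  have hν : ∀ n, IsProbabilityMeasure (ν n) := fun n => ⟨by
    simp only [ν, Measure.coe_finsetSum, Finset.sum_apply, Measure.smul_apply, measure_univ,
      smul_eq_mul, mul_one]
    rw [← ENNReal.ofReal_sum_of_nonneg fun i _ => ((hR (L n)).2.1 i).le, (hR (L n)).2.2,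
      ENNReal.ofReal_one]⟩
  have hcyl : ∀ (ℓ : {ℓ : ℕ // 1 ≤ ℓ}) (k : ℤ) (w : LegalWord p ℓ), ∀ᶠ n in atTop,
      ν n (cylinder p k w.1) = ENNReal.ofReal (R ℓ w) := by
    intro ℓ k w
    filter_upwards [eventually_ge_atTop (k.natAbs + ℓ)] with n hn
    have hkn : k = -(n : ℤ) + ((k + n).toNat : ℕ) := by omega
    set j := (k + n).toNat with hj
    have hjL : j + w.1.length ≤ 2 * n + 1 := by rw [w.2.2]; omega
    have h1 : ∀ W : LegalWord p (L n), (Measure.dirac (⟨pt n W, hpt n W⟩ : hull p))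
        (cylinder p k w.1) = ENNReal.ofReal (wordIndicator w.1 ((W.1.drop j).take ℓ)) := by
      intro W
      rw [Measure.dirac_apply' _ (measurableSet_cylinder _ _)]
      have hmem : (⟨pt n W, hpt n W⟩ : hull p) ∈ cylinder p (-(n : ℤ)) W.1 :=
        mem_cylinder.2 (hptw n W)
      have h2 := mem_cylinder_iff_of_mem W.2.2 hjL hmem
      rw [← hkn, w.2.2] at h2
      by_cases h3 : (W.1.drop j).take ℓ = w.1
      · rw [Set.indicator_of_mem (h2.2 h3), wordIndicator, if_pos h3]
        simp
      · rw [Set.indicator_of_notMem fun h => h3 (h2.1 h), wordIndicator, if_neg h3]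
        simp
    simp only [ν, Measure.coe_finsetSum, Finset.sum_apply, Measure.smul_apply, smul_eq_mul, h1]
    have h4 : ∀ W : LegalWord p (L n), ENNReal.ofReal (R (L n) W) *
        ENNReal.ofReal (wordIndicator w.1 ((W.1.drop j).take ℓ)) =
        ENNReal.ofReal (wordIndicator w.1 ((W.1.drop j).take ℓ) * R (L n) W) := fun W => by
      rw [← ENNReal.ofReal_mul ((hR (L n)).2.1 W).le, mul_comm]
    simp only [h4]
    rw [← ENNReal.ofReal_sum_of_nonneg fun W _ =>
      mul_nonneg (wordIndicator_nonneg _ _) ((hR (L n)).2.1 W).le]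
    congr 1
    rw [sum_marginal_eq (B := 1) hm hp ℓ.2 (by rw [w.2.2] at hjL; exact hjL) (hR ℓ) (hR (L n))
      (fun u => by unfold wordIndicator; split_ifs <;> simp)]
    have h5 : ∀ u : LegalWord p ℓ, wordIndicator w.1 u.1 = if u = w then 1 else 0 := fun u => by
      simp only [wordIndicator, Subtype.ext_iff]
    simp [h5]
  let νP : ℕ → ProbabilityMeasure (hull p) := fun n => ⟨ν n, hν n⟩
  obtain ⟨μ, -, hμ⟩ := isCompact_univ.ultrafilter_le_nhds
    (Ultrafilter.map νP (hyperfilter ℕ)) (by simp)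
  have hμ' : Tendsto νP (hyperfilter ℕ : Filter ℕ) (𝓝 μ) := hμ
  refine ⟨μ, fun ℓ hℓ => ⟨R ⟨ℓ, hℓ⟩, hR ⟨ℓ, hℓ⟩, fun k w => ?_⟩⟩
  have h1 := ProbabilityMeasure.tendsto_measure_of_isClopen_of_tendsto hμ'
    (isClopen_cylinder k w.1)
  have h2 : Tendsto (fun n => ((νP n (cylinder p k w.1) : NNReal) : ℝ≥0∞))
      (hyperfilter ℕ : Filter ℕ) (𝓝 (μ (cylinder p k w.1) : NNReal)) :=
    ENNReal.tendsto_coe.2 h1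
  simp only [ProbabilityMeasure.ennreal_coeFn_eq_coeFn_toMeasure] at h2
  refine tendsto_nhds_unique h2 (tendsto_const_nhds.congr' ?_)
  filter_upwards [Nat.hyperfilter_le_atTop (hcyl ⟨ℓ, hℓ⟩ k w)] with n hn
  exact hn.symm

end Measure

/-! ### Ergodicity -/

section Ergodicity

open MeasureTheory Filter

variable {m : ℕ} {p : PMF (Fin (m + 1))}

lemma measurable_hullShift : Measurable (hullShift p) := by
  refine Measurable.subtype_mk (measurable_pi_iff.2 fun n => ?_)
  exact (measurable_pi_apply (n + 1)).comp measurable_subtype_coe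

lemma preimage_hullShift_cylinder (k : ℤ) (v : List Letter) :
    hullShift p ⁻¹' cylinder p k v = cylinder p (k + 1) v := by
  ext x
  rw [Set.mem_preimage, mem_cylinder, mem_cylinder, hullShift, subword_shift]

lemma IsNobleMeasure.measurePreserving (hm : 1 ≤ m) (hp : ∀ i, 0 < p i) {μ : Measure (hull p)}
    (hμ : IsNobleMeasure p μ) : MeasurePreserving (hullShift p) μ μ := by
  have h1 := hμ.isProbabilityMeasure hm hp
  refine ⟨measurable_hullShift, (ext_of_generate_finite _ generateFrom_centralCylinders
    isPiSystem_centralCylinders ?_ ?_).symm⟩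
  · rintro _ ⟨n, v, hv, rfl⟩
    rw [Measure.map_apply measurable_hullShift (measurableSet_cylinder _ _),
      preimage_hullShift_cylinder]
    exact hμ.measure_cylinder_eq hm hp hμ _ _ (by omega)
  · rw [Measure.map_apply measurable_hullShift MeasurableSet.univ, Set.preimage_univ]

/-- An invariant set is independent of all cylinder sets. -/
lemma IsNobleMeasure.measureReal_inter_cylinder (hm : 1 ≤ m) (hp : ∀ i, 0 < p i)
    {μ : Measure (hull p)} (hμ : IsNobleMeasure p μ) {A : Set (hull p)} (hA : MeasurableSet A)
    (hinv : hullShift p ⁻¹' A = A) (k : ℤ) {v : List Letter} (hv : 1 ≤ v.length) :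
    μ.real (A ∩ cylinder p k v) = μ.real (cylinder p k v) * μ.real A := by
  have h1 := hμ.isProbabilityMeasure hm hp
  by_cases hleg : Legal p v
  swap
  · rw [cylinder_eq_empty hm hp hleg, Set.inter_empty, measureReal_empty, zero_mul]
  obtain ⟨R, hR, hμR⟩ := hμ v.length hv
  have hreal : ∀ (ℓ : ℕ) (R : LegalWord p ℓ → ℝ), IsRightPF (inducedMatrix p ℓ) R →
      (∀ (k : ℤ) (w : LegalWord p ℓ), μ (cylinder p k w.1) = ENNReal.ofReal (R w)) →
      ∀ w : LegalWord p ℓ, μ.real (cylinder p k w.1) = R w := fun ℓ R hR h w => by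
    rw [Measure.real, h, ENNReal.toReal_ofReal (hR.2.1 w).le]
  have hc := hreal _ R hR hμR ⟨v, hleg, rfl⟩
  set c := R ⟨v, hleg, rfl⟩ with hc_def
  have hc' : μ.real (cylinder p k v) = c := hc
  have hc0 : 0 ≤ c := (hR.2.1 _).le
  -- All translates of the cylinder set meet `A` in the same mass.
  have hshift : ∀ j : ℕ, μ.real (A ∩ cylinder p (k + j) v) = μ.real (A ∩ cylinder p k v) := by
    intro j
    induction j with
    | zero => simp
    | succ j ih =>
      rw [← ih, Nat.cast_succ, ← add_assoc, ← preimage_hullShift_cylinder]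
      nth_rw 1 [← hinv]
      rw [← Set.preimage_inter]
      exact (hμ.measurePreserving hm hp).measureReal_preimage
        (hA.inter (measurableSet_cylinder _ _)).nullMeasurableSet
  set φ : List Letter → ℝ := fun u => wordIndicator v u - c with hφ
  have hφB : ∀ u, |φ u| ≤ 1 + c := fun u => by
    refine (abs_sub _ _).trans (add_le_add ?_ (abs_of_nonneg hc0).le)
    unfold wordIndicator; split_ifs <;> simp
  have hφ0 : ∑ w : LegalWord p v.length, φ w.1 * R w = 0 := by
    simp only [hφ, sub_mul, Finset.sum_sub_distrib, ← Finset.mul_sum, hR.2.2]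
    have h5 : ∀ u : LegalWord p v.length, wordIndicator v u.1 =
        if u = ⟨v, hleg, rfl⟩ then 1 else 0 := fun u => by
      simp only [wordIndicator, Subtype.ext_iff]
    simp [h5, hc_def]
  have key : ∀ ε : ℝ, 0 < ε → |μ.real (A ∩ cylinder p k v) - c * μ.real A| ≤ ε := by
    intro ε hε
    obtain ⟨n, hn1, hn⟩ := exists_sum_abs_windowSum_le hm hp hv hR hφB hφ0 hε
    obtain ⟨R', hR', hμR'⟩ := hμ (n + v.length) (by omega)
    have hn0 : (0 : ℝ) < n := by exact_mod_cast hn1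
    -- By `hshift`, the measure of the intersection is the integral over `A` of the frequency of `v`
    -- in the window of length `n`.
    have h2 : (n : ℝ) * (μ.real (A ∩ cylinder p k v) - c * μ.real A) =
        ∑ W : LegalWord p (n + v.length),
          windowSum φ v.length n W.1 * μ.real (A ∩ cylinder p k W.1) := by
      have h3 : ∀ j ∈ Finset.range n, μ.real (A ∩ cylinder p k v) - c * μ.real A =
          ∑ W : LegalWord p (n + v.length),
            φ ((W.1.drop j).take v.length) * μ.real (A ∩ cylinder p k W.1) := by
        intro j hj
        rw [Finset.mem_range] at hj
        rw [← hshift j, measureReal_inter_cylinder_eq_sum hm hp μ hA k (L := n + v.length)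
          (by omega), measureReal_eq_sum_cylinder hm hp μ hA k (n + v.length), Finset.mul_sum,
          ← Finset.sum_sub_distrib]
        exact Finset.sum_congr rfl fun W _ => by rw [hφ]; ring
      have h4 := Finset.sum_congr (rfl : Finset.range n = _) h3
      rw [Finset.sum_const, Finset.card_range, nsmul_eq_mul, Finset.sum_comm] at h4
      rw [h4]
      exact Finset.sum_congr rfl fun W _ => by rw [windowSum, Finset.sum_mul]
    have h5 : (n : ℝ) * |μ.real (A ∩ cylinder p k v) - c * μ.real A| ≤ n * ε := by
      rw [← abs_of_pos hn0, ← abs_mul, h2, abs_of_pos hn0]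
      refine (Finset.abs_sum_le_sum_abs _ _).trans ((Finset.sum_le_sum fun W _ => ?_).trans
        ((hn R' hR').trans_eq (mul_comm _ _)))
      rw [abs_mul, abs_of_nonneg measureReal_nonneg]
      refine mul_le_mul_of_nonneg_left ?_ (abs_nonneg _)
      rw [← hreal _ R' hR' hμR' W]
      exact measureReal_mono Set.inter_subset_right
    exact le_of_mul_le_mul_left h5 hn0
  have h6 := abs_eq_zero.1 (le_antisymm (le_of_forall_pos_le_add fun ε hε => by
    simpa using key ε hε) (abs_nonneg (μ.real (A ∩ cylinder p k v) - c * μ.real A)))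
  rw [hc']
  linarith

lemma IsNobleMeasure.ergodic (hm : 1 ≤ m) (hp : ∀ i, 0 < p i) {μ : Measure (hull p)}
    (hμ : IsNobleMeasure p μ) : Ergodic (hullShift p) μ := by
  have h1 := hμ.isProbabilityMeasure hm hp
  refine ⟨hμ.measurePreserving hm hp, ⟨fun A hA hinv => ?_⟩⟩
  have h2 : μ.restrict A = μ A • μ := by
    refine ext_of_generate_finite _ generateFrom_centralCylinders isPiSystem_centralCylinders ?_ ?_
    · rintro _ ⟨n, v, hv, rfl⟩
      rw [Measure.restrict_apply (measurableSet_cylinder _ _), Set.inter_comm, Measure.smul_apply,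
        smul_eq_mul, ← ENNReal.toReal_eq_toReal_iff' (measure_ne_top _ _)
        (ENNReal.mul_ne_top (measure_ne_top _ _) (measure_ne_top _ _)), ENNReal.toReal_mul,
        mul_comm]
      exact hμ.measureReal_inter_cylinder hm hp hA hinv _ (by omega)
    · rw [Measure.restrict_apply_univ, Measure.smul_apply, measure_univ, smul_eq_mul, mul_one]
  -- An invariant set is independent of all measurable sets, in particular of itself.
  have h3 : μ A = μ A * μ A := by
    have := congrArg (fun ν : Measure (hull p) => ν A) h2
    simpa [Measure.restrict_apply hA] using this
  rw [eventuallyConst_set]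
  by_cases h0 : μ A = 0
  · exact Or.inr (measure_eq_zero_iff_ae_notMem.1 h0)
  · left
    have h4 : μ A = 1 := by
      have h5 : μ A * μ A = μ A * 1 := by rw [mul_one, ← h3]
      exact (ENNReal.mul_right_inj h0 (measure_ne_top _ _)).1 h5
    exact (prob_compl_eq_zero_iff hA).2 h4

end Ergodicity

end RNMS

theorem mainTheorem2 (m : ℕ) (hm : 1 ≤ m) (p : PMF (Fin (m + 1))) (hp : ∀ i, 0 < p i) :
    (∀ ℓ : ℕ, 1 ≤ ℓ → ∃! R : RNMS.LegalWord p ℓ → ℝ,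
      RNMS.IsRightPF (RNMS.inducedMatrix p ℓ) R) ∧
    (∃! μ : MeasureTheory.Measure (RNMS.hull p), RNMS.IsNobleMeasure p μ) ∧
    ∀ μ : MeasureTheory.Measure (RNMS.hull p), RNMS.IsNobleMeasure p μ →
      MeasureTheory.IsProbabilityMeasure μ ∧ Ergodic (RNMS.hullShift p) μ := by
  refine ⟨fun ℓ hℓ => RNMS.existsUnique_isRightPF_inducedMatrix hm hp hℓ, ?_, fun μ hμ =>
    ⟨hμ.isProbabilityMeasure hm hp, hμ.ergodic hm hp⟩⟩
  obtain ⟨μ, hμ⟩ := RNMS.exists_isNobleMeasure hm hp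
  exact ⟨μ, hμ, fun ν hν => hν.eq hm hp hμ⟩
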